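/- Let $\mathbb{N}=\{1,2,\dots\}$. For $\mathscr{B}\subset\mathbb{N}$ let $\mathcal{M}_{\mathscr{B}}=\bigcup_{b\in\mathscr{B}}b\mathbb{Z}$ and $\mathcal{F}_{\mathscr{B}}=\mathbb{Z}\setminus\mathcal{M}_{\mathscr{B}}$. The set $\mathscr{B}$ is \emph{taut} if $\boldsymbol{\delta}(\mathcal{M}_{\mathscr{B}\setminus\{b\}})<\boldsymbol{\delta}(\mathcal{M}_{\mathscr{B}})$ for every $b\in\mathscr{B}$, where $\boldsymbol{\delta}(A)=\lim_{N\to\infty}\frac1{\log N}\sum_{a\in A,\,1\le a\le N}\frac1a$ is the logarithmic density (by a theorem of Davenport and Erdős it exists for every set of multiples, and it then equals the corresponding $\liminf$). Let $S$ be the left shift on $\{0,1\}^{\mathbb{Z}}$, let $\eta=\mathbf{1}_{\mathcal{F}_{\mathscr{B}}}\in\{0,1\}^{\mathbb{Z}}$ and $X_\eta=\overline{\{S^k\eta : k\in\mathbb{Z}\}}$. Let $G$ be the closure of $\{(n,n,\dots) : n\in\mathbb{Z}\}$ in the compact group $\prod_{b\in\mathscr{B}}\mathbb{Z}/b\mathbb{Z}$,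 let $\mathbb{P}$ be its Haar probability measure and $Tg=g+(1,1,\dots)$; $(T,G,\mathbb{P})$ is the canonical odometer of $\mathscr{B}$. Let $C=\{g\in G : g_b\neq 0 \text{ for all } b\in\mathscr{B}\}$, define $\varphi\colon G\to\{0,1\}^{\mathbb{Z}}$ by $\varphi(g)(n)=\mathbf{1}_C(T^ng)$, and let $\nu_\eta=\varphi_*\mathbb{P}$ be the Mirsky measure. \textbf{Theorem.} Suppose that $\mathscr{B}\subset\mathbb{N}$ is taut. Then $\nu_\eta(X_\eta)=1$, the maps $T$ and $S|_{X_\eta}$ preserve the probability measures $\mathbb{P}$ and $\nu_\eta|_{X_\eta}$ respectively, and $\varphi$ yields an isomorphism of the measure-theoretic dynamical systems $(T,G,\mathbb{P})$ and $(S,X_\eta,\nu_\eta)$: there are measurable sets $G_0\subset G$ and $X_0\subset X_\eta$ of full measure, with $T^{-1}G_0=G_0$ and $S^{-1}X_0=X_0$, such that $\varphi$ restricts to a measure-preserving Borel isomorphism $G_0\to X_0$ with $\varphi\circ T=S\circ\varphi$ on $G_0$. In particular, $(S,X_\eta,\nu_\eta)$ has zero measure-theoretic (Kolmogorov--Sinai)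 entropy. -/

import Mathlib

open Filter Topology MeasureTheory

noncomputable section

namespace BFree

/-! ## Sets of multiples and tautness -/

/-- The set of multiples `M_B`, the union of `b ℤ` over `b ∈ B`. -/
def multiples (B : Set ℕ+) : Set ℤ := {m | ∃ b ∈ B, ((b : ℕ) : ℤ) ∣ m}

/-- The set `F_B` of `B`-free integers. -/
def free (B : Set ℕ+) : Set ℤ := (multiples B)ᶜ

open Classical in
/-- The lower logarithmic density of (the positive part of) a set of integers. The averages are
bounded, so the `liminf` is a genuine one; it is the logarithmic density of `A` whenever the
averages converge. -/
def lowerLogDensity (A : Set ℤ) : ℝ :=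
  liminf (fun N : ℕ =>
    (∑ a ∈ (Finset.Icc 1 N).filter (fun a : ℕ => (a : ℤ) ∈ A), (1 : ℝ) / a) / Real.log N) atTop

/-- `B` is taut if removing any element of `B` strictly decreases the logarithmic density of the
set of multiples. Every set of multiples has a logarithmic density (Davenport and Erdős), which is
then its lower logarithmic density; with the latter the existence need not be presupposed. -/
def IsTaut (B : Set ℕ+) : Prop :=
  ∀ b ∈ B, lowerLogDensity (multiples (B \ {b})) < lowerLogDensity (multiples B)

/-! ## The `B`-free subshift -/

/-- The left shift on `{0,1}^ℤ`. -/
def shift : Equiv.Perm (ℤ → Fin 2) where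
  toFun x n := x (n + 1)
  invFun x n := x (n - 1)
  left_inv x := by funext n; simp
  right_inv x := by funext n; simp

open Classical in
/-- The characteristic function `η` of the set of `B`-free integers. -/
def eta (B : Set ℕ+) : ℤ → Fin 2 := fun n => if n ∈ free B then 1 else 0

/-- `X_η`, the closure of the orbit of `η` under the shift, in the product topology. -/
def subshift (B : Set ℕ+) : Set (ℤ → Fin 2) :=
  closure (Set.range fun k : ℤ => (shift ^ k) (eta B))

theorem continuous_shift : Continuous shift :=
  continuous_pi fun n => continuous_apply (n + 1)

theorem continuous_shift_symm : Continuous shift.symm :=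
  continuous_pi fun n => continuous_apply (n - 1)

theorem shift_mem_subshift_iff (B : Set ℕ+) (x : ℤ → Fin 2) :
    shift x ∈ subshift B ↔ x ∈ subshift B := by
  constructor
  · intro h
    have h1 : Set.MapsTo shift.symm (Set.range fun k : ℤ => (shift ^ k) (eta B))
        (Set.range fun k : ℤ => (shift ^ k) (eta B)) := by
      rintro _ ⟨k, rfl⟩
      refine ⟨-1 + k, ?_⟩
      simp only [zpow_add, zpow_neg_one, Equiv.Perm.mul_apply]
      rfl
    have h2 := h1.closure continuous_shift_symm h
    rwa [Equiv.symm_apply_apply] at h2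
  · intro h
    have h1 : Set.MapsTo shift (Set.range fun k : ℤ => (shift ^ k) (eta B))
        (Set.range fun k : ℤ => (shift ^ k) (eta B)) := by
      rintro _ ⟨k, rfl⟩
      exact ⟨1 + k, by simp only [zpow_add, zpow_one, Equiv.Perm.mul_apply]⟩
    exact h1.closure continuous_shift h

/-- The shift as a bijection of `X_η`. -/
def subshiftMap (B : Set ℕ+) : Equiv.Perm (subshift B) :=
  shift.subtypePerm (shift_mem_subshift_iff B)

/-! ## The canonical odometer -/

/-- The group `G`: the closure of `{(n, n, …) : n ∈ ℤ}` in the product of the groups `ℤ/bℤ` over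
`b ∈ B`, with the product of the discrete topologies. The factors are indexed by the elements of
`B` themselves, which is the same as an enumeration of `B` and covers finite `B` as well. -/
abbrev Odometer (B : Set ℕ+) : Type :=
  (Int.castAddHom (∀ b : B, ZMod ((b : ℕ+) : ℕ))).range.topologicalClosure

instance (B : Set ℕ+) : CompactSpace (Odometer B) :=
  isCompact_iff_compactSpace.mp
    (AddSubgroup.isClosed_topologicalClosure
      (Int.castAddHom (∀ b : B, ZMod ((b : ℕ+) : ℕ))).range).isCompact

instance {n : ℕ} : BorelSpace (ZMod n) := ⟨by rw [borel_eq_top_of_discrete]; rfl⟩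

/-- Haar probability measure on the compact group `G`. -/
def haar (B : Set ℕ+) : Measure (Odometer B) := Measure.addHaarMeasure ⊤

/-- The element `(1, 1, …)` of `G`. -/
def odometerOne (B : Set ℕ+) : Odometer B :=
  ⟨1, AddSubgroup.le_topologicalClosure _ ⟨1, by simp⟩⟩

/-- The rotation `T g = g + (1, 1, …)`. -/
def odometerMap (B : Set ℕ+) : Equiv.Perm (Odometer B) := Equiv.addRight (odometerOne B)

/-- The set `C` of the points of `G` that have no coordinate equal to zero. -/
def window (B : Set ℕ+) : Set (Odometer B) := {g | ∀ b : B, (g : ∀ b : B, ZMod ((b : ℕ+) : ℕ)) b ≠ 0}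

open Classical in
/-- The coding map `φ : G → {0,1}^ℤ`, where `φ(g)(n) = 1` exactly if `T^n g ∈ C`. -/
def coding (B : Set ℕ+) (g : Odometer B) : ℤ → Fin 2 :=
  fun n => if (odometerMap B ^ n) g ∈ window B then 1 else 0

/-- The Mirsky measure `ν_η`, the image of Haar measure under `φ`, as a measure on `{0,1}^ℤ`. -/
def mirskyMeasure (B : Set ℕ+) : Measure (ℤ → Fin 2) := (haar B).map (coding B)

/-- The Mirsky measure, restricted to the Borel subsets of `X_η`. -/
def mirskyOnSubshift (B : Set ℕ+) : Measure (subshift B) := (mirskyMeasure B).comap Subtype.val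

/-! ## Isomorphism and entropy of measure-preserving systems -/

/-- An isomorphism of the measure-theoretic dynamical systems `(T, X, μ)` and `(S, Y, ν)`: an
equivariant measure-preserving Borel isomorphism between invariant measurable sets of full
measure. -/
structure SystemIso {X Y : Type*} [MeasurableSpace X] [MeasurableSpace Y]
    (T : X → X) (μ : Measure X) (S : Y → Y) (ν : Measure Y) where
  source : Set X
  target : Set Y
  measurableSet_source : MeasurableSet source
  measurableSet_target : MeasurableSet target
  source_full : μ sourceᶜ = 0
  target_full : ν targetᶜ = 0
  source_invariant : T ⁻¹' source = source
  target_invariant : S ⁻¹' target = target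
  toEquiv : source ≃ᵐ target
  measurePreserving : MeasurePreserving toEquiv (μ.comap Subtype.val) (ν.comap Subtype.val)
  equivariant : ∀ x y : source, (y : X) = T x → (toEquiv y : Y) = S (toEquiv x)

/-- Shannon entropy of a random variable with values in a finite set (equivalently, of the finite
partition into its level sets); `Real.negMulLog t = - t log t`. -/
def shannonEntropy {X ι : Type*} [MeasurableSpace X] [Fintype ι] (μ : Measure X) (P : X → ι) : ℝ :=
  ∑ i, Real.negMulLog (μ.real (P ⁻¹' {i}))

/-- The entropy of `T` with respect to the finite partition into the level sets of `P`: the limit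
of `H(P ∨ T⁻¹P ∨ ⋯ ∨ T^{-(N-1)}P) / N`. -/
def partitionEntropy {X : Type*} [MeasurableSpace X] (T : X → X) (μ : Measure X) {k : ℕ}
    (P : X → Fin k) : ENNReal :=
  limsup (fun N : ℕ =>
    ENNReal.ofReal (shannonEntropy μ (fun x => fun i : Fin N => P (T^[i] x)) / N)) atTop

/-- The Kolmogorov-Sinai entropy of `T` with respect to an invariant probability measure `μ`: the
supremum of the entropies with respect to finite measurable partitions. -/
def measureEntropy {X : Type*} [MeasurableSpace X] (T : X → X) (μ : Measure X) : ENNReal :=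
  ⨆ (k : ℕ) (P : X → Fin k) (_ : Measurable P), partitionEntropy T μ P

end BFree

end

noncomputable section

namespace BFree

/-! ## Mertens' upper bound -/

/-! Injectivity of the coding. Suppose `g` and `h` have the same coding but differ at `b`, and put
`r = g_b - h_b ≠ 0`. If the orbit of `g` visits `C` at a time `n` when its `b`-coordinate is `r`,
then the `b`-coordinate of `T^n h` is `0`, so `T^n h ∉ C` and the codings differ at `n`. Hence the
coding is injective on the points whose orbits visit `C ∩ {g_b = r}` for all `b` and all `r ≠ 0`
(`injOn_coding_separated`). The rotation is ergodic, so almost every point has this property once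
all these sets have positive measure.

Positivity comes from tautness. If the points whose only zero coordinate is at `b` formed a null
set, finitely many coordinates would already show that removing `b` lowers the logarithmic density
by less than any given `ε` (`IsTaut.measure_pos`). A Chinese remainder argument (`exists_translate`)
gives, for every finite `F`, an integer translation that takes multiples of `b` to the class `r` and
creates no new divisor in `F`. By invariance of Haar measure, `C ∩ {g_b = r}` is at least as large
as that set of points.

Concentration on the subshift. Let `τ_F` be the measure of the points with no zero in `F` but a zero
elsewhere. A Davenport–Erdős estimate bounds the sum of `1/n` over the multiples `n ≤ x` of `B` that
are not multiples of `F` by `C τ_F log x` (`exists_sum_inv_newMultiples_le`); it rests on Mertens'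
bound for the product over primes. If a block of length `L` never occurs in `η`, each occurrence in
the `F`-free approximation is spoiled by such a multiple nearby, so the block has measure at most a
constant times `τ_F`. As `F` grows `τ_F` tends to zero, so almost every coding contains only blocks
of `η`.

The Lusin–Souslin theorem makes the inverse of the coding Borel. Entropy vanishes because rotation
by a number divisible by many `b` is close to the identity: every finite partition process is almost
periodic in measure (`shannonEntropy_le`), and the coding carries this over to the subshift. -/

theorem prod_primesLE_pow_dvd_factorial (N : ℕ) :
    ∏ p ∈ Nat.primesLE N, p ^ (N / p) ∣ N.factorial := by
  refine Finset.prod_dvd_of_isRelPrime ?_ ?_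
  · intro p hp q hq hpq
    exact Nat.coprime_iff_isRelPrime.1 (Nat.Coprime.pow _ _
      ((Nat.coprime_primes (Nat.prime_of_mem_primesLE hp) (Nat.prime_of_mem_primesLE hq)).2 hpq))
  · intro p hp
    have hp' := Nat.prime_of_mem_primesLE hp
    rw [hp'.pow_dvd_factorial_iff (Nat.lt_succ_self _)]
    have : N / p = N / p ^ 1 := by simp
    rw [this]
    refine Finset.single_le_sum (f := fun i => N / p ^ i) (fun _ _ => Nat.zero_le _) ?_
    have h1 : 1 ≤ Nat.log p N := Nat.log_pos hp'.one_lt (Nat.le_of_mem_primesLE hp)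
    exact Finset.mem_Ico.2 ⟨le_rfl, by omega⟩

/-- The floors `N / p` give a sum of at most `log N! ≤ N log N`; replacing them by the quotients
costs at most Chebyshev's `θ(N) ≤ N log 4`. -/
theorem sum_log_div_primesLE_le {N : ℕ} (hN : 1 ≤ N) :
    ∑ p ∈ Nat.primesLE N, Real.log p / p ≤ Real.log N + Real.log 4 := by
  have hN' : (0 : ℝ) < N := by exact_mod_cast hN
  have h1 : ∑ p ∈ Nat.primesLE N, ((N / p : ℕ) : ℝ) * Real.log p ≤ N * Real.log N := by
    have h2 : ∏ p ∈ Nat.primesLE N, p ^ (N / p) ≤ N ^ N :=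
      (Nat.le_of_dvd (Nat.factorial_pos _) (prod_primesLE_pow_dvd_factorial N)).trans
        (Nat.factorial_le_pow N)
    have h3 : (0 : ℝ) < ((∏ p ∈ Nat.primesLE N, p ^ (N / p) : ℕ) : ℝ) := by
      exact_mod_cast Finset.prod_pos fun p hp =>
        pow_pos (Nat.prime_of_mem_primesLE hp).pos _
    have h4 := Real.log_le_log h3 (by exact_mod_cast h2 : _ ≤ ((N ^ N : ℕ) : ℝ))
    push_cast at h4
    rw [Real.log_prod, Real.log_pow] at h4
    · simpa [Real.log_pow] using h4
    · intro p hp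
      exact pow_ne_zero _ (by exact_mod_cast (Nat.prime_of_mem_primesLE hp).ne_zero)
  have h5 : ∑ p ∈ Nat.primesLE N, Real.log p ≤ N * Real.log 4 := by
    have := Chebyshev.theta_le_log4_mul_x (x := N) hN'.le
    rw [Chebyshev.theta_eq_sum_primesLE_log] at this
    linarith
  have h6 : N * ∑ p ∈ Nat.primesLE N, Real.log p / p ≤
      ∑ p ∈ Nat.primesLE N, ((N / p : ℕ) : ℝ) * Real.log p + ∑ p ∈ Nat.primesLE N, Real.log p := by
    rw [Finset.mul_sum, ← Finset.sum_add_distrib]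
    refine Finset.sum_le_sum fun p hp => ?_
    have hp' := (Nat.prime_of_mem_primesLE hp)
    have h7 : (N : ℝ) / p ≤ (N / p : ℕ) + 1 := by
      rw [← Nat.floor_div_eq_div (K := ℝ)]
      exact (Nat.lt_floor_add_one _).le
    have h8 : 0 ≤ Real.log p := Real.log_natCast_nonneg p
    calc (N : ℝ) * (Real.log p / p) = N / p * Real.log p := by ring
      _ ≤ ((N / p : ℕ) + 1) * Real.log p := by gcongr
      _ = _ := by ring
  have h9 : N * ∑ p ∈ Nat.primesLE N, Real.log p / p ≤ N * (Real.log N + Real.log 4) := by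
    linarith
  exact le_of_mul_le_mul_left h9 hN'

/-- The right side is the integral of `t ^ (-(1 + σ))` over `[n, n + 1]`. It telescopes in `n` and
gives `ζ(1 + σ) ≤ 1 + 1/σ`. -/
theorem rpow_neg_add_le {σ : ℝ} (hσ : 0 < σ) {n : ℕ} (hn : 1 ≤ n) :
    ((n + 1 : ℕ) : ℝ) ^ (-(1 + σ)) ≤ ((n : ℝ) ^ (-σ) - ((n + 1 : ℕ) : ℝ) ^ (-σ)) / σ := by
  have hn0 : (0 : ℝ) < n := by exact_mod_cast hn
  have hn1 : (0 : ℝ) < ((n + 1 : ℕ) : ℝ) := by positivity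
  have h1 : (n : ℝ) ^ (-σ) = ((n + 1 : ℕ) : ℝ) ^ (-σ) * Real.exp (σ * Real.log ((n + 1 : ℕ) / n)) := by
    rw [Real.rpow_def_of_pos hn0, Real.rpow_def_of_pos hn1, ← Real.exp_add,
      Real.log_div hn1.ne' hn0.ne']
    ring_nf
  have h2 : 1 - (((n + 1 : ℕ) : ℝ) / n)⁻¹ ≤ Real.log ((n + 1 : ℕ) / n) :=
    Real.one_sub_inv_le_log_of_pos (by positivity)
  have h3 : 1 - (((n + 1 : ℕ) : ℝ) / n)⁻¹ = ((n + 1 : ℕ) : ℝ)⁻¹ := by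
    field_simp; push_cast; ring
  have h4 : 1 + σ * ((n + 1 : ℕ) : ℝ)⁻¹ ≤ Real.exp (σ * Real.log ((n + 1 : ℕ) / n)) := by
    have := Real.add_one_le_exp (σ * Real.log ((n + 1 : ℕ) / n))
    have h5 : σ * ((n + 1 : ℕ) : ℝ)⁻¹ ≤ σ * Real.log ((n + 1 : ℕ) / n) := by
      rw [← h3]; gcongr
    linarith
  have h6 : ((n + 1 : ℕ) : ℝ) ^ (-(1 + σ)) = ((n + 1 : ℕ) : ℝ) ^ (-σ) * ((n + 1 : ℕ) : ℝ)⁻¹ := by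
    rw [neg_add, Real.rpow_add hn1, Real.rpow_neg_one, mul_comm]
  rw [le_div_iff₀ hσ, h6, h1]
  have h7 : 0 ≤ ((n + 1 : ℕ) : ℝ) ^ (-σ) := by positivity
  nlinarith [mul_le_mul_of_nonneg_left h4 h7]

theorem sum_Icc_rpow_neg_le {σ : ℝ} (hσ : 0 < σ) (N : ℕ) :
    ∑ n ∈ Finset.Icc 1 (N + 1), (n : ℝ) ^ (-(1 + σ)) ≤ 1 + 1 / σ := by
  have h : ∑ n ∈ Finset.Icc 1 (N + 1), (n : ℝ) ^ (-(1 + σ)) ≤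
      1 + (1 - ((N + 1 : ℕ) : ℝ) ^ (-σ)) / σ := by
    induction N with
    | zero => simp
    | succ N ih =>
      rw [Finset.sum_Icc_succ_top (by omega)]
      have := rpow_neg_add_le hσ (n := N + 1) (by omega)
      have e : 1 + (1 - ((N + 1 + 1 : ℕ) : ℝ) ^ (-σ)) / σ = 1 + (1 - ((N + 1 : ℕ) : ℝ) ^ (-σ)) / σ
        + (((N + 1 : ℕ) : ℝ) ^ (-σ) - ((N + 1 + 1 : ℕ) : ℝ) ^ (-σ)) / σ := by ring
      rw [e]
      linarith
  refine h.trans ?_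
  have : 0 ≤ ((N + 1 : ℕ) : ℝ) ^ (-σ) := by positivity
  gcongr
  linarith

/-- The product is the sum of `n ^ (-(1 + σ))` over the numbers `n` without prime factors above `x`,
a part of the series for `ζ(1 + σ)`. -/
theorem prod_primesLE_inv_one_sub_rpow_le {σ : ℝ} (hσ : 0 < σ) (x : ℕ) :
    ∏ p ∈ Nat.primesLE x, (1 - (p : ℝ) ^ (-(1 + σ)))⁻¹ ≤ 1 + 1 / σ := by
  let f : ℕ →* ℝ :=
    { toFun := fun n => (n : ℝ) ^ (-(1 + σ))
      map_one' := by simp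
      map_mul' := fun m n => by
        push_cast; exact Real.mul_rpow (Nat.cast_nonneg _) (Nat.cast_nonneg _) }
  have hf : ∀ {p : ℕ}, p.Prime → ‖f p‖ < 1 := by
    intro p hp
    have : (0 : ℝ) ≤ (p : ℝ) ^ (-(1 + σ)) := by positivity
    change ‖(p : ℝ) ^ (-(1 + σ))‖ < 1
    rw [Real.norm_of_nonneg this]
    exact Real.rpow_lt_one_of_one_lt_of_neg (by exact_mod_cast hp.one_lt) (by linarith)
  have hs := (EulerProduct.summable_and_hasSum_smoothNumbers_prod_primesBelow_geometric hf (x + 1)).2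
  refine hasSum_le_of_sum_le hs fun s => ?_
  obtain ⟨N, hN⟩ : ∃ N, ∀ m ∈ s, (m : ℕ) ≤ N + 1 :=
    ⟨s.sup (fun m => (m : ℕ)), fun m hm =>
      (Finset.le_sup (f := fun m : (x + 1).smoothNumbers => (m : ℕ)) hm).trans (Nat.le_succ _)⟩
  refine le_trans ?_ (sum_Icc_rpow_neg_le hσ N)
  refine (Finset.sum_map s (Function.Embedding.subtype _) (fun n : ℕ => f n)).symm.trans_le ?_
  refine Finset.sum_le_sum_of_subset_of_nonneg ?_ fun n _ _ =>
    Real.rpow_nonneg (Nat.cast_nonneg _) _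
  intro n hn
  obtain ⟨m, hm, rfl⟩ := Finset.mem_map.1 hn
  exact Finset.mem_Icc.2 ⟨Nat.pos_of_ne_zero (Nat.ne_zero_of_mem_smoothNumbers m.2), hN m hm⟩

/-- The cost of moving an Euler factor from exponent `1 + σ` to exponent `1`. The factor `2`
compensates for `1 - 1/p ≥ 1/2`. -/
theorem inv_one_sub_inv_le {σ : ℝ} (hσ : 0 < σ) {p : ℕ} (hp : p.Prime) :
    (1 - (p : ℝ)⁻¹)⁻¹ ≤ (1 - (p : ℝ) ^ (-(1 + σ)))⁻¹ * Real.exp (2 * σ * (Real.log p / p)) := by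
  have hp2 : (2 : ℝ) ≤ p := by exact_mod_cast hp.two_le
  have hp0 : (0 : ℝ) < p := by linarith
  have hi : (p : ℝ)⁻¹ ≤ 2⁻¹ := by gcongr
  have hip : 0 < (p : ℝ)⁻¹ := by positivity
  have hlt : (p : ℝ) ^ (-(1 + σ)) < 1 :=
    Real.rpow_lt_one_of_one_lt_of_neg (by linarith) (by linarith)
  have h1 : (p : ℝ) ^ (-(1 + σ)) = (p : ℝ)⁻¹ * Real.exp (-(σ * Real.log p)) := by
    rw [neg_add, Real.rpow_add hp0, Real.rpow_neg_one, Real.rpow_def_of_pos hp0]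
    ring_nf
  have h2 := Real.add_one_le_exp (-(σ * Real.log p))
  have h3 := Real.add_one_le_exp (2 * σ * (Real.log p / p))
  have hl : 0 ≤ Real.log p := Real.log_natCast_nonneg p
  have key : 1 - (p : ℝ) ^ (-(1 + σ)) ≤
      (1 - (p : ℝ)⁻¹) * Real.exp (2 * σ * (Real.log p / p)) := by
    have h4 : 1 - (p : ℝ) ^ (-(1 + σ)) ≤ 1 - (p : ℝ)⁻¹ + (p : ℝ)⁻¹ * (σ * Real.log p) := by
      rw [h1]; nlinarith
    have h5 : (1 - (p : ℝ)⁻¹) * (2 * σ * (Real.log p / p) + 1) ≤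
        (1 - (p : ℝ)⁻¹) * Real.exp (2 * σ * (Real.log p / p)) := by
      gcongr; linarith
    have h6 : 0 ≤ σ * Real.log p * (p : ℝ)⁻¹ := by positivity
    have h7 : (1 - (p : ℝ)⁻¹) * (2 * σ * (Real.log p / p) + 1) =
      (1 - (p : ℝ)⁻¹) + (1 - (p : ℝ)⁻¹) * 2 * (σ * Real.log p * (p : ℝ)⁻¹) := by
      rw [div_eq_mul_inv]; ring
    nlinarith
  have ha : 0 < 1 - (p : ℝ)⁻¹ := by linarith
  have hb : 0 < 1 - (p : ℝ) ^ (-(1 + σ)) := by linarith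
  rw [inv_le_iff_one_le_mul₀ ha, mul_comm, ← mul_assoc, mul_comm _ (_)⁻¹, mul_assoc,
    ← div_eq_inv_mul, le_div_iff₀ hb, one_mul]
  exact key

/-- An upper bound of the order given by Mertens' third theorem. -/
theorem exists_prod_primesLE_inv_one_sub_inv_le : ∃ C : ℝ, 0 < C ∧ ∀ x : ℕ, 3 ≤ x →
    ∏ p ∈ Nat.primesLE x, (1 - (p : ℝ)⁻¹)⁻¹ ≤ C * Real.log x := by
  refine ⟨2 * Real.exp (2 * (1 + Real.log 4)), by positivity, fun x hx => ?_⟩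
  have hx' : (3 : ℝ) ≤ x := by exact_mod_cast hx
  have hL : 1 ≤ Real.log x := by
    rw [Real.le_log_iff_exp_le (by linarith)]
    exact (Real.exp_one_lt_d9.le.trans (by norm_num)).trans hx'
  -- This choice balances both factors: `1 + 1/σ` has order `log x`, while `σ ∑ log p / p` stays
  -- bounded.
  set σ := 1 / Real.log x with hσ
  have hσ0 : 0 < σ := by positivity
  calc ∏ p ∈ Nat.primesLE x, (1 - (p : ℝ)⁻¹)⁻¹
      ≤ ∏ p ∈ Nat.primesLE x, ((1 - (p : ℝ) ^ (-(1 + σ)))⁻¹ *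
          Real.exp (2 * σ * (Real.log p / p))) := by
        refine Finset.prod_le_prod (fun p hp => ?_) fun p hp =>
          inv_one_sub_inv_le hσ0 (Nat.prime_of_mem_primesLE hp)
        rw [inv_nonneg, sub_nonneg]
        exact inv_le_one_of_one_le₀ (by exact_mod_cast (Nat.prime_of_mem_primesLE hp).one_le)
    _ = (∏ p ∈ Nat.primesLE x, (1 - (p : ℝ) ^ (-(1 + σ)))⁻¹) *
          Real.exp (2 * σ * ∑ p ∈ Nat.primesLE x, Real.log p / p) := by
        rw [Finset.prod_mul_distrib, ← Real.exp_sum, Finset.mul_sum]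
    _ ≤ (1 + 1 / σ) * Real.exp (2 * (1 + Real.log 4)) := by
        refine mul_le_mul (prod_primesLE_inv_one_sub_rpow_le hσ0 x) (Real.exp_le_exp.2 ?_)
          (Real.exp_pos _).le (by positivity)
        · rw [mul_assoc]
          refine mul_le_mul_of_nonneg_left ?_ zero_le_two
          calc σ * ∑ p ∈ Nat.primesLE x, Real.log p / p ≤ σ * (Real.log x + Real.log 4) := by
                gcongr; exact sum_log_div_primesLE_le (by omega)
            _ = 1 + σ * Real.log 4 := by
                rw [mul_add, hσ, one_div, inv_mul_cancel₀ (by linarith)]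
            _ ≤ 1 + 1 * Real.log 4 := by
                have : σ ≤ 1 := div_le_one_of_le₀ hL (by linarith)
                have := Real.log_nonneg (show (1 : ℝ) ≤ 4 by norm_num)
                nlinarith
            _ = _ := by ring
    _ ≤ (2 * Real.log x) * Real.exp (2 * (1 + Real.log 4)) := by
        gcongr
        rw [hσ, one_div_one_div]; linarith
    _ = _ := by ring

/-! ## Periodic sets of natural numbers -/

section Periodic

variable {Q : ℕ → Prop} [DecidablePred Q] {N : ℕ}

theorem count_mul_of_periodic (hQ : Function.Periodic Q N) (k : ℕ) :
    Nat.count Q (N * k) = k * Nat.count Q N := by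
  induction k with
  | zero => simp
  | succ k ih =>
    rw [mul_add, mul_one, add_comm, Nat.count_add]
    have : (fun j => Q (N + j)) = Q := by
      funext j; rw [add_comm]; exact hQ j
    simp only [this, ih]
    ring

theorem card_filter_Ico_of_periodic (hQ : Function.Periodic Q N) (k : ℕ) :
    ((Finset.Ico (k * N + 1) ((k + 1) * N + 1)).filter Q).card = Nat.count Q N := by
  rw [← Nat.filter_Ico_card_eq_of_periodic (k * N + 1) N Q hQ]
  congr 3; ring

theorem sum_inv_mul_succ (k : ℕ) :
    ∑ n ∈ (Finset.Icc 1 ((k + 1) * N)).filter Q, (1 : ℝ) / n =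
      ∑ n ∈ (Finset.Icc 1 (k * N)).filter Q, (1 : ℝ) / n +
      ∑ n ∈ (Finset.Ico (k * N + 1) ((k + 1) * N + 1)).filter Q, (1 : ℝ) / n := by
  rw [Finset.sum_filter, Finset.sum_filter, Finset.sum_filter]
  have h : ∀ m, Finset.Icc 1 m = Finset.Ico 1 (m + 1) := fun m => by
    ext; simp
  rw [h, h, Finset.sum_Ico_consecutive _ (by omega)]
  gcongr; omega

theorem mul_harmonic_le_sum_inv (hN : 0 < N) (hQ : Function.Periodic Q N) (k : ℕ) :
    (Nat.count Q N : ℝ) / N * (harmonic k : ℝ) ≤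
      ∑ n ∈ (Finset.Icc 1 (k * N)).filter Q, (1 : ℝ) / n := by
  induction k with
  | zero => simp
  | succ k ih =>
    rw [sum_inv_mul_succ, harmonic_succ]
    have h : (Nat.count Q N : ℝ) * (1 / ((k + 1) * N : ℕ)) ≤
        ∑ n ∈ (Finset.Ico (k * N + 1) ((k + 1) * N + 1)).filter Q, (1 : ℝ) / n := by
      rw [← card_filter_Ico_of_periodic hQ k, ← nsmul_eq_mul]
      refine Finset.card_nsmul_le_sum _ _ _ fun n hn => ?_
      simp only [Finset.mem_filter, Finset.mem_Ico] at hn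
      have : 0 < n := by omega
      gcongr
      omega
    have e : (Nat.count Q N : ℝ) * (1 / ((k + 1) * N : ℕ)) =
        (Nat.count Q N : ℝ) / N * ((k + 1 : ℕ) : ℝ)⁻¹ := by
      have : (N : ℝ) ≠ 0 := by positivity
      push_cast; field_simp
    push_cast at *
    rw [mul_add]
    linarith

/-- In each block of length `N` after the first, reciprocals are bounded by that of the preceding
block's end, hence `k + 1` blocks against `harmonic k`. The first block is bounded trivially by `N`.
-/
theorem sum_inv_le_add_mul_harmonic (hN : 0 < N) (hQ : Function.Periodic Q N) (k : ℕ) :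
    ∑ n ∈ (Finset.Icc 1 ((k + 1) * N)).filter Q, (1 : ℝ) / n ≤
      N + (Nat.count Q N : ℝ) / N * (harmonic k : ℝ) := by
  induction k with
  | zero =>
    simp only [zero_add, one_mul, harmonic_zero, Rat.cast_zero, mul_zero, add_zero]
    calc _ ≤ ∑ n ∈ (Finset.Icc 1 N).filter Q, (1 : ℝ) := by
          refine Finset.sum_le_sum fun n hn => ?_
          simp only [Finset.mem_filter, Finset.mem_Icc] at hn
          rw [div_le_one (by exact_mod_cast hn.1.1)]
          exact_mod_cast hn.1.1
      _ ≤ N := by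
          rw [Finset.sum_const, nsmul_eq_mul, mul_one]
          have := Finset.card_filter_le (Finset.Icc 1 N) Q
          rw [Nat.card_Icc] at this
          exact_mod_cast this
  | succ k ih =>
    rw [sum_inv_mul_succ, harmonic_succ]
    have h : ∑ n ∈ (Finset.Ico ((k + 1) * N + 1) ((k + 1 + 1) * N + 1)).filter Q, (1 : ℝ) / n ≤
        (Nat.count Q N : ℝ) * (1 / ((k + 1) * N : ℕ)) := by
      rw [← card_filter_Ico_of_periodic hQ (k + 1), ← nsmul_eq_mul]
      refine Finset.sum_le_card_nsmul _ _ _ fun n hn => ?_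
      simp only [Finset.mem_filter, Finset.mem_Ico] at hn
      gcongr
      omega
    have e : (Nat.count Q N : ℝ) * (1 / ((k + 1) * N : ℕ)) =
        (Nat.count Q N : ℝ) / N * ((k + 1 : ℕ) : ℝ)⁻¹ := by
      have : (N : ℝ) ≠ 0 := by positivity
      push_cast; field_simp
    push_cast at *
    rw [mul_add]
    linarith

theorem mul_log_sub_le_sum_inv (hN : 0 < N) (hQ : Function.Periodic Q N) {x : ℕ} (hx : 1 ≤ x) :
    (Nat.count Q N : ℝ) / N * (Real.log x - Real.log N) ≤
      ∑ n ∈ (Finset.Icc 1 x).filter Q, (1 : ℝ) / n := by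
  have hN' : (0 : ℝ) < N := by exact_mod_cast hN
  have hx' : (0 : ℝ) < x := by exact_mod_cast hx
  have h1 : Real.log x - Real.log N ≤ harmonic (x / N) := by
    refine le_trans ?_ (log_add_one_le_harmonic (x / N))
    rw [← Real.log_div hx'.ne' hN'.ne']
    refine Real.log_le_log (by positivity) ?_
    rw [← Nat.floor_div_eq_div (K := ℝ)]
    push_cast
    exact (Nat.lt_floor_add_one _).le
  calc _ ≤ (Nat.count Q N : ℝ) / N * (harmonic (x / N) : ℝ) := by gcongr
    _ ≤ _ := mul_harmonic_le_sum_inv hN hQ _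
    _ ≤ _ := by
      refine Finset.sum_le_sum_of_subset_of_nonneg ?_ fun n _ _ => by positivity
      exact Finset.filter_subset_filter _ (Finset.Icc_subset_Icc_right (Nat.div_mul_le_self x N))

theorem sum_inv_le_mul_log_add (hN : 0 < N) (hQ : Function.Periodic Q N) (x : ℕ) :
    ∑ n ∈ (Finset.Icc 1 x).filter Q, (1 : ℝ) / n ≤
      (Nat.count Q N : ℝ) / N * (1 + Real.log x) + N := by
  have hl : 0 ≤ Real.log x := Real.log_natCast_nonneg x
  have h1 : (harmonic (x / N) : ℝ) ≤ 1 + Real.log x := by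
    rcases Nat.eq_zero_or_pos (x / N) with h | h
    · rw [h]; simp; linarith
    · refine (harmonic_le_one_add_log _).trans ?_
      gcongr
      exact Nat.div_le_self x N
  calc _ ≤ ∑ n ∈ (Finset.Icc 1 ((x / N + 1) * N)).filter Q, (1 : ℝ) / n := by
        refine Finset.sum_le_sum_of_subset_of_nonneg ?_ fun n _ _ => by positivity
        refine Finset.filter_subset_filter _ (Finset.Icc_subset_Icc_right ?_)
        rw [mul_comm]; exact (Nat.lt_mul_div_succ x hN).le
    _ ≤ _ := sum_inv_le_add_mul_harmonic hN hQ _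
    _ ≤ N + (Nat.count Q N : ℝ) / N * (1 + Real.log x) := by gcongr
    _ = _ := add_comm _ _

/-! ### Density of sets stable under multiplication by numbers without small prime factors -/

theorem count_coprime_mul (P k : ℕ) : Nat.count (Nat.Coprime P) (P * k) = k * P.totient := by
  rw [count_mul_of_periodic (Nat.periodic_coprime P), Nat.totient_eq_card_coprime,
    Nat.count_eq_card_filter_range]

theorem coprime_of_coprime_primorial {x n k : ℕ} (hn : 1 ≤ n) (hnx : n ≤ x)
    (hk : (primorial x).Coprime k) : n.Coprime k := by
  refine Nat.coprime_of_dvd fun p hp hpn hpk => ?_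
  have h1 : p ∣ primorial x := by
    rw [primorial_eq_prod_primesLE]
    exact Finset.dvd_prod_of_mem (fun p => p)
      (Nat.mem_primesLE.2 ⟨(Nat.le_of_dvd hn hpn).trans hnx, hp⟩)
  exact Nat.not_coprime_of_dvd_of_dvd hp.one_lt h1 hpk hk

/-- If a periodic set contains, with every `n ≤ x`, the products of `n` with the numbers free of
primes up to `x`, then the reciprocal sum over its members up to `x` is controlled by its
density. -/
theorem sum_inv_mul_totient_le_density (hN : 0 < N) (hQ : Function.Periodic Q N) {x : ℕ}
    (h : ∀ n, 1 ≤ n → n ≤ x → Q n → ∀ k, (primorial x).Coprime k → Q (n * k)) :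
    (∑ n ∈ (Finset.Icc 1 x).filter Q, (1 : ℝ) / n) *
      (((primorial x).totient : ℝ) / primorial x) ≤ (Nat.count Q N : ℝ) / N := by
  set P := primorial x with hP
  have hP0 : 0 < P := primorial_pos x
  -- With this factor every `n ≤ x` divides `N * X`, so the quotients `N * X / n` are exact and one
  -- common period serves all `n`.
  set X := x.factorial
  have hX0 : 0 < X := Nat.factorial_pos x
  set M := N * (X * P) with hM
  -- If `n k = m l` with `n, m ≤ x` and `k, l` free of primes up to `x`, then `n` and `m` divide
  -- each other. The disjoint sets of products have densities `φ(P) / (P n)`, which add up.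
  have hdisj : ((Finset.Icc 1 x).filter Q : Set ℕ).PairwiseDisjoint fun n =>
      ((Finset.range (P * (N * X / n))).filter (Nat.Coprime P)).image (n * ·) := by
    intro n hn m hm hnm
    simp only [Finset.coe_filter, Finset.mem_Icc, Set.mem_ofPred_eq] at hn hm
    refine Finset.disjoint_left.2 fun a ha hb => hnm ?_
    obtain ⟨k, hk, rfl⟩ := Finset.mem_image.1 ha
    obtain ⟨l, hl, hkl⟩ := Finset.mem_image.1 hb
    have hk := (Finset.mem_filter.1 hk).2
    have hl := (Finset.mem_filter.1 hl).2
    exact Nat.dvd_antisymm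
      ((coprime_of_coprime_primorial hn.1.1 hn.1.2 hl).dvd_of_dvd_mul_right
        (Dvd.intro k hkl.symm))
      ((coprime_of_coprime_primorial hm.1.1 hm.1.2 hk).dvd_of_dvd_mul_right
        (Dvd.intro l hkl))
  have hsub : ((Finset.Icc 1 x).filter Q).biUnion (fun n =>
      ((Finset.range (P * (N * X / n))).filter (Nat.Coprime P)).image (n * ·)) ⊆
      (Finset.range M).filter Q := by
    intro a ha
    obtain ⟨n, hn, ha⟩ := Finset.mem_biUnion.1 ha
    obtain ⟨k, hk, rfl⟩ := Finset.mem_image.1 ha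
    simp only [Finset.mem_filter, Finset.mem_Icc, Finset.mem_range] at hn hk ⊢
    refine ⟨?_, h n hn.1.1 hn.1.2 hn.2 k hk.2⟩
    calc n * k < n * (P * (N * X / n)) := by
          exact Nat.mul_lt_mul_of_pos_left hk.1 hn.1.1
      _ = (n * (N * X / n)) * P := by ring
      _ ≤ (N * X) * P := Nat.mul_le_mul_right _ (Nat.mul_div_le _ _)
      _ = M := by rw [hM]; ring
  have hcard := Finset.card_le_card hsub
  rw [Finset.card_biUnion hdisj, ← Nat.count_eq_card_filter_range, hM,
    count_mul_of_periodic hQ] at hcard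
  have hterm : ∀ n ∈ (Finset.Icc 1 x).filter Q,
      (((Finset.range (P * (N * X / n))).filter (Nat.Coprime P)).image (n * ·)).card =
        N * X / n * P.totient := by
    intro n hn
    simp only [Finset.mem_filter, Finset.mem_Icc] at hn
    rw [Finset.card_image_of_injective _ (fun a b hab => Nat.eq_of_mul_eq_mul_left hn.1.1 hab),
      ← Nat.count_eq_card_filter_range, count_coprime_mul]
  rw [Finset.sum_congr rfl hterm] at hcard
  have hN' : (0 : ℝ) < N := by exact_mod_cast hN
  have hP' : (0 : ℝ) < P := by exact_mod_cast hP0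
  have hX' : (0 : ℝ) < X := by exact_mod_cast hX0
  have hcard' : ∑ n ∈ (Finset.Icc 1 x).filter Q, (N * X : ℝ) * (1 / n) * P.totient ≤
      X * P * Nat.count Q N := by
    have e : ∑ n ∈ (Finset.Icc 1 x).filter Q, (N * X : ℝ) * (1 / n) * P.totient =
        ((∑ n ∈ (Finset.Icc 1 x).filter Q, N * X / n * P.totient : ℕ) : ℝ) := by
      push_cast
      refine Finset.sum_congr rfl fun n hn => ?_
      simp only [Finset.mem_filter, Finset.mem_Icc] at hn
      rw [Nat.cast_div ((Nat.dvd_factorial hn.1.1 hn.1.2).mul_left N)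
        (by have := hn.1.1; positivity)]
      push_cast; ring
    rw [e]
    exact_mod_cast hcard
  rw [← Finset.sum_mul, ← Finset.mul_sum] at hcard'
  rw [le_div_iff₀ hN', ← mul_div_assoc, div_mul_eq_mul_div, div_le_iff₀ hP']
  refine le_of_mul_le_mul_left ?_ hX'
  linarith

theorem totient_primorial_div (x : ℕ) :
    ((primorial x).totient : ℝ) / primorial x =
      (∏ p ∈ Nat.primesLE x, (1 - (p : ℝ)⁻¹)⁻¹)⁻¹ := by
  have h := congrArg (Rat.cast (K := ℝ)) (Nat.totient_eq_mul_prod_factors (primorial x))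
  push_cast at h
  have h0 : (primorial x : ℝ) ≠ 0 := by exact_mod_cast (primorial_pos x).ne'
  rw [h, mul_div_cancel_left₀ _ h0, primeFactors_primorial, Finset.prod_inv_distrib, inv_inv]

end Periodic

/-- By Mertens the loss `φ(P)/P` is at least of order `1 / log x`, which matches the normalisation
of logarithmic density. It matters that `C` depends on neither the set nor its period. -/
theorem exists_sum_inv_le_density_mul_log : ∃ C : ℝ, 0 < C ∧
    ∀ (Q : ℕ → Prop) [DecidablePred Q] (N x : ℕ), 3 ≤ x → 0 < N → Function.Periodic Q N →
      (∀ n, 1 ≤ n → n ≤ x → Q n → ∀ k, (primorial x).Coprime k → Q (n * k)) →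
      ∑ n ∈ (Finset.Icc 1 x).filter Q, (1 : ℝ) / n ≤
        C * Real.log x * ((Nat.count Q N : ℝ) / N) := by
  obtain ⟨C, hC, h⟩ := exists_prod_primesLE_inv_one_sub_inv_le
  refine ⟨C, hC, fun Q _ N x hx hN hQ hmul => ?_⟩
  have h1 := sum_inv_mul_totient_le_density hN hQ hmul
  have hpos : 0 < ∏ p ∈ Nat.primesLE x, (1 - (p : ℝ)⁻¹)⁻¹ := by
    refine Finset.prod_pos fun p hp => ?_
    rw [inv_pos, sub_pos]
    exact inv_lt_one_of_one_lt₀ (by exact_mod_cast (Nat.prime_of_mem_primesLE hp).one_lt)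
  rw [totient_primorial_div, ← div_eq_mul_inv, div_le_iff₀ hpos] at h1
  calc _ ≤ _ := h1
    _ ≤ (Nat.count Q N : ℝ) / N * (C * Real.log x) := by gcongr; exact h x hx
    _ = _ := mul_comm _ _

/-! ## A translation that moves multiples of `b` into another residue class -/

theorem natCast_dvd_iff_prime_pow {f : ℕ} {m : ℤ} :
    (f : ℤ) ∣ m ↔ ∀ p k : ℕ, p.Prime → p ^ k ∣ f → ((p ^ k : ℕ) : ℤ) ∣ m := by
  simp only [Int.natCast_dvd]
  exact Nat.dvd_iff_prime_pow_dvd_dvd _ _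

/-- Chinese remainder theorem for the splitting of `N` into the part `U` composed of primes in `S`
and the complementary part `V`. -/
theorem exists_prime_pow_dvd_sub_or_dvd {N : ℕ} (hN : 0 < N) (S : ℕ → Prop) (r : ℤ) :
    ∃ e : ℤ, ∀ p k : ℕ, p.Prime → p ^ k ∣ N →
      (S p → ((p ^ k : ℕ) : ℤ) ∣ e - r) ∧ (¬ S p → ((p ^ k : ℕ) : ℤ) ∣ e) := by
  classical
  set U : ℤ := ∏ p ∈ N.primeFactors.filter S, (p : ℤ) ^ N.factorization p with hU
  set V : ℤ := ∏ p ∈ N.primeFactors.filter (fun p => ¬ S p), (p : ℤ) ^ N.factorization p with hV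
  have hcop : IsCoprime U V := by
    refine IsCoprime.prod_left fun p hp => IsCoprime.prod_right fun q hq => IsCoprime.pow ?_
    rw [Finset.mem_filter, Nat.mem_primeFactors] at hp hq
    rw [Nat.isCoprime_iff_coprime, Nat.coprime_primes hp.1.1 hq.1.1]
    rintro rfl
    exact hq.2 hp.2
  obtain ⟨a, c, hac⟩ := hcop
  have hdvd : ∀ p k : ℕ, p.Prime → p ^ k ∣ N →
      (S p → ((p ^ k : ℕ) : ℤ) ∣ U) ∧ (¬ S p → ((p ^ k : ℕ) : ℤ) ∣ V) := by
    intro p k hp hk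
    rcases Nat.eq_zero_or_pos k with rfl | hk0
    · simp
    have hmem : p ∈ N.primeFactors :=
      Nat.mem_primeFactors.2 ⟨hp, (dvd_pow_self p hk0.ne').trans hk, hN.ne'⟩
    have hle := (hp.pow_dvd_iff_le_factorization hN.ne').1 hk
    have h1 : ((p ^ k : ℕ) : ℤ) ∣ (p : ℤ) ^ N.factorization p := by
      push_cast; exact pow_dvd_pow _ hle
    exact ⟨fun hS => h1.trans (Finset.dvd_prod_of_mem (fun p : ℕ => (p : ℤ) ^ N.factorization p)
        (Finset.mem_filter.2 ⟨hmem, hS⟩)),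
      fun hS => h1.trans (Finset.dvd_prod_of_mem (fun p : ℕ => (p : ℤ) ^ N.factorization p)
        (Finset.mem_filter.2 ⟨hmem, hS⟩))⟩
  refine ⟨r * c * V, fun p k hp hk => ⟨fun hS => ?_, fun hS => ?_⟩⟩
  · have e : r * c * V - r = U * (-(r * a)) := by linear_combination r * hac
    rw [e]
    exact ((hdvd p k hp hk).1 hS).mul_right _
  · exact ((hdvd p k hp hk).2 hS).mul_left _

/-- Take `e ≡ r` at the primes `p` where the `p`-part of `b` does not divide `r`, and `e ≡ 0` at the
others. Only the former can create a divisor `p ^ k` of `n + e`. If `p ^ k` divides `b`, it divides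
`n` anyway; otherwise the `p`-part of `b` would divide `n + e` and `n`, hence `r`, a contradiction.
-/
theorem exists_translate {b : ℕ} (hb : 0 < b) (F : Finset ℕ) (hF : ∀ f ∈ F, 0 < f) (r : ℤ) :
    ∃ e : ℤ, ∀ n : ℤ, (b : ℤ) ∣ n →
      (b : ℤ) ∣ n + e - r ∧ ∀ f ∈ F, (f : ℤ) ∣ n + e → (f : ℤ) ∣ n := by
  have hN : 0 < b * ∏ f ∈ F, f := Nat.mul_pos hb (Finset.prod_pos hF)
  obtain ⟨e, he⟩ := exists_prime_pow_dvd_sub_or_dvd hN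
    (fun p => ¬ ((p ^ b.factorization p : ℕ) : ℤ) ∣ r) r
  refine ⟨e, fun n hn => ⟨?_, fun f hf hfn => ?_⟩⟩
  · rw [natCast_dvd_iff_prime_pow]
    intro p k hp hk
    have hkn : ((p ^ k : ℕ) : ℤ) ∣ n := (Int.natCast_dvd_natCast.2 hk).trans hn
    obtain ⟨h1, h2⟩ := he p k hp (hk.mul_right _)
    by_cases h : ((p ^ b.factorization p : ℕ) : ℤ) ∣ r
    · have hr : ((p ^ k : ℕ) : ℤ) ∣ r :=
        (Int.natCast_dvd_natCast.2
          (pow_dvd_pow _ ((hp.pow_dvd_iff_le_factorization hb.ne').1 hk))).trans h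
      exact dvd_sub (dvd_add hkn (h2 (not_not.2 h))) hr
    · rw [add_sub_assoc]
      exact dvd_add hkn (h1 h)
  · rw [natCast_dvd_iff_prime_pow]
    intro p k hp hk
    have hkn : ((p ^ k : ℕ) : ℤ) ∣ n + e := (Int.natCast_dvd_natCast.2 hk).trans hfn
    obtain ⟨h1, h2⟩ := he p k hp ((hk.trans (Finset.dvd_prod_of_mem (fun f => f) hf)).mul_left _)
    by_cases h : ((p ^ b.factorization p : ℕ) : ℤ) ∣ r
    · exact (dvd_add_left (h2 (not_not.2 h))).1 hkn
    · by_cases hle : k ≤ b.factorization p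
      · exact (Int.natCast_dvd_natCast.2
          ((hp.pow_dvd_iff_le_factorization hb.ne').2 hle)).trans hn
      · refine absurd ?_ h
        have h3 : ((p ^ b.factorization p : ℕ) : ℤ) ∣ ((p ^ k : ℕ) : ℤ) :=
          Int.natCast_dvd_natCast.2 (pow_dvd_pow _ (by omega))
        have h4 : ((p ^ b.factorization p : ℕ) : ℤ) ∣ n :=
          (Int.natCast_dvd_natCast.2 (Nat.ordProj_dvd b p)).trans hn
        have h5 : r = (n + e) - (e - r) - n := by ring
        rw [h5]
        exact dvd_sub (dvd_sub (h3.trans hkn) (h3.trans (h1 h))) h4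

/-! ## The odometer -/

section Odometer

variable {B : Set ℕ+}

instance (n : ℕ) : Countable (ZMod n) := by
  cases n with
  | zero => exact inferInstanceAs (Countable ℤ)
  | succ n => exact inferInstanceAs (Countable (Fin (n + 1)))

instance : SecondCountableTopology (Odometer B) :=
  haveI : ∀ n : ℕ, SecondCountableTopology (ZMod n) := fun _ =>
    DiscreteTopology.secondCountableTopology_of_countable
  TopologicalSpace.Subtype.secondCountableTopology _

instance : PolishSpace (Odometer B) :=
  (AddSubgroup.isClosed_topologicalClosure
      (Int.castAddHom (∀ b : B, ZMod ((b : ℕ+) : ℕ))).range).polishSpace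

instance : (haar B).IsAddHaarMeasure := by unfold haar; infer_instance

instance : IsProbabilityMeasure (haar B) :=
  ⟨Measure.addHaarMeasure_self (K₀ := (⊤ : TopologicalSpace.PositiveCompacts (Odometer B)))⟩

theorem odometerMap_zpow_apply (n : ℤ) (g : Odometer B) :
    (odometerMap B ^ n) g = g + n • odometerOne B := by
  have h : odometerMap B ^ n = Equiv.addRight (n • odometerOne B) := by
    simp [odometerMap]
  rw [h]; rfl

theorem zsmul_odometerOne_apply (n : ℤ) (b : B) :
    (n • odometerOne B : Odometer B).1 b = (n : ZMod ((b : ℕ+) : ℕ)) := by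
  simp [odometerOne]

theorem odometerMap_zpow_apply_coe (n : ℤ) (g : Odometer B) (b : B) :
    ((odometerMap B ^ n) g).1 b = g.1 b + (n : ZMod ((b : ℕ+) : ℕ)) := by
  rw [odometerMap_zpow_apply, ← zsmul_odometerOne_apply n b]
  rfl

theorem measurePreserving_odometerMap_zpow (n : ℤ) :
    MeasurePreserving (odometerMap B ^ n) (haar B) (haar B) := by
  have h := measurePreserving_add_right (haar B) (n • odometerOne B)
  have e : ⇑(odometerMap B ^ n) = (· + n • odometerOne B) :=
    funext fun g => odometerMap_zpow_apply n g
  rw [e]; exact h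

theorem exists_int_forall_eq (F : Finset B) (g : Odometer B) :
    ∃ n : ℤ, ∀ b ∈ F, g.1 b = (n : ZMod ((b : ℕ+) : ℕ)) := by
  have hg : g.1 ∈ closure
      ((Int.castAddHom (∀ b : B, ZMod ((b : ℕ+) : ℕ))).range : Set (∀ b : B, ZMod ((b : ℕ+) : ℕ))) :=
    g.2
  have hopen : IsOpen {x : ∀ b : B, ZMod ((b : ℕ+) : ℕ) | ∀ b ∈ F, x b = g.1 b} := by
    have : {x : ∀ b : B, ZMod ((b : ℕ+) : ℕ) | ∀ b ∈ F, x b = g.1 b} =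
        Set.pi (F : Set B) fun b => {g.1 b} := by
      ext x; simp [Set.mem_pi]
    rw [this]
    exact isOpen_set_pi F.finite_toSet fun b _ => isOpen_discrete _
  obtain ⟨x, hx, n, rfl⟩ := mem_closure_iff.1 hg _ hopen fun b _ => rfl
  exact ⟨n, fun b hb => (by simpa using (hx b hb).symm)⟩

theorem exists_nat_forall_eq (F : Finset B) (g : Odometer B) :
    ∃ n : ℕ, ∀ b ∈ F, g.1 b = ((n : ℤ) : ZMod ((b : ℕ+) : ℕ)) := by
  obtain ⟨n, hn⟩ := exists_int_forall_eq F g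
  have hN : (0 : ℤ) < ((∏ f ∈ F, ((f : ℕ+) : ℕ) : ℕ) : ℤ) := by
    exact Int.natCast_pos.2 (Finset.prod_pos fun f _ => (f : ℕ+).pos)
  refine ⟨(n % ((∏ f ∈ F, ((f : ℕ+) : ℕ) : ℕ) : ℤ)).toNat, fun b hb => ?_⟩
  rw [hn b hb, Int.toNat_of_nonneg (Int.emod_nonneg _ hN.ne'), ZMod.intCast_eq_intCast_iff]
  refine Int.ModEq.symm ((Int.mod_modEq n _).of_dvd ?_)
  exact Int.natCast_dvd_natCast.2 (Finset.dvd_prod_of_mem (fun f : B => ((f : ℕ+) : ℕ)) hb)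

theorem denseRange_zsmul_odometerOne : DenseRange fun n : ℤ => n • odometerOne B := by
  rw [DenseRange, dense_iff_inter_open]
  rintro U ⟨V, hV, rfl⟩ ⟨g, hg⟩
  obtain ⟨x, hx, n, rfl⟩ := mem_closure_iff.1 (show g.1 ∈ closure
      ((Int.castAddHom (∀ b : B, ZMod ((b : ℕ+) : ℕ))).range :
        Set (∀ b : B, ZMod ((b : ℕ+) : ℕ))) from g.2) V hV hg
  refine ⟨n • odometerOne B, ?_, n, rfl⟩
  have : (n • odometerOne B : Odometer B).1 =
      Int.castAddHom (∀ b : B, ZMod ((b : ℕ+) : ℕ)) n := by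
    funext b; rw [zsmul_odometerOne_apply]; simp
  rw [Set.mem_preimage, this]; exact hx

theorem ergodic_odometerMap : Ergodic (odometerMap B) (haar B) := by
  have h := ergodic_add_left_of_denseRange_zsmul denseRange_zsmul_odometerOne (haar B)
  have e : (odometerMap B : Odometer B → Odometer B) = fun x => odometerOne B + x :=
    funext fun g => add_comm _ _
  rw [e]; exact h

theorem measurable_apply_odometer (b : B) :
    Measurable fun g : Odometer B => g.1 b :=
  (measurable_pi_apply b).comp measurable_subtype_coe

theorem measurableSet_apply_eq (b : B) (r : ZMod ((b : ℕ+) : ℕ)) :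
    MeasurableSet {g : Odometer B | g.1 b = r} :=
  measurable_apply_odometer b (MeasurableSet.of_discrete (s := {r}))

/-- The points without zeros among the coordinates in `F`. -/
def windowOn (F : Set B) : Set (Odometer B) := {g | ∀ b ∈ F, g.1 b ≠ 0}

theorem windowOn_univ : windowOn (Set.univ : Set B) = window B := by
  ext g; simp [windowOn, window]

theorem measurableSet_windowOn (F : Set B) : MeasurableSet (windowOn F) := by
  have : windowOn F = ⋂ b ∈ F, {g : Odometer B | g.1 b = 0}ᶜ := by
    ext g; simp [windowOn]
  rw [this]
  exact MeasurableSet.biInter F.to_countable fun b _ => (measurableSet_apply_eq b 0).compl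

theorem measurableSet_window : MeasurableSet (window B) :=
  windowOn_univ (B := B) ▸ measurableSet_windowOn _

/-- A set of points and a set of integers that are given by the same condition on the coordinates
in a finite set. -/
def IsCylinder (F : Finset B) (E : Set (Odometer B)) (Q : ℤ → Prop) : Prop :=
  ∀ (g : Odometer B) (n : ℤ), (∀ b ∈ F, g.1 b = (n : ZMod ((b : ℕ+) : ℕ))) → (g ∈ E ↔ Q n)

theorem prod_coe_pos (F : Finset B) : 0 < ∏ f ∈ F, ((f : ℕ+) : ℕ) :=
  Finset.prod_pos fun f _ => (f : ℕ+).pos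

theorem IsCylinder.periodic {F : Finset B} {E : Set (Odometer B)} {Q : ℤ → Prop}
    (h : IsCylinder F E Q) :
    Function.Periodic (fun n : ℕ => Q n) (∏ f ∈ F, ((f : ℕ+) : ℕ)) := by
  intro n
  have h1 := h ((n : ℤ) • odometerOne B) n fun b _ => zsmul_odometerOne_apply _ b
  have h2 := h ((n : ℤ) • odometerOne B) (n + ∏ f ∈ F, ((f : ℕ+) : ℕ) : ℕ) fun b hb => by
    rw [zsmul_odometerOne_apply, ZMod.intCast_eq_intCast_iff]
    refine (Int.modEq_iff_dvd.2 ?_)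
    push_cast
    rw [add_sub_cancel_left]
    exact_mod_cast Finset.dvd_prod_of_mem (fun f : B => ((f : ℕ+) : ℕ)) hb
  exact propext (h2.symm.trans h1)

theorem IsCylinder.measurableSet {F : Finset B} {E : Set (Odometer B)} {Q : ℤ → Prop}
    (h : IsCylinder F E Q) : MeasurableSet E := by
  have : E = ⋃ n ∈ {n : ℕ | Q n}, ⋂ b ∈ F, {g : Odometer B | g.1 b = ((n : ℤ) : ZMod ((b : ℕ+) : ℕ))} := by
    ext g
    simp only [Set.mem_iUnion, Set.mem_iInter, Set.mem_ofPred_eq, exists_prop]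
    constructor
    · intro hg
      obtain ⟨n, hn⟩ := exists_nat_forall_eq F g
      exact ⟨n, (h g n hn).1 hg, hn⟩
    · rintro ⟨n, hQ, hn⟩
      exact (h g n hn).2 hQ
  rw [this]
  exact MeasurableSet.biUnion (Set.to_countable _) fun n _ =>
    Finset.measurableSet_biInter _ fun b _ => measurableSet_apply_eq b _

theorem integral_sum_odometerMap {φ : Odometer B → ℝ} (hφ : Integrable φ (haar B)) (N : ℕ) :
    ∫ g, ∑ j ∈ Finset.range N, φ ((odometerMap B ^ (j : ℤ)) g) ∂haar B = N * ∫ g, φ g ∂haar B := by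
  have h1 : ∀ j : ℕ, ∫ g, φ ((odometerMap B ^ (j : ℤ)) g) ∂haar B = ∫ g, φ g ∂haar B := by
    intro j
    simp only [odometerMap_zpow_apply]
    exact integral_add_right_eq_self φ _
  rw [integral_finsetSum]
  · simp only [h1, Finset.sum_const, Finset.card_range, nsmul_eq_mul]
  · intro j _
    simp only [odometerMap_zpow_apply]
    exact hφ.comp_add_right _

/-- Along `N` consecutive rotations every point visits `E` equally often, namely as often as `Q`
holds in one period. Integrating this constant over `G` gives the measure. -/
theorem IsCylinder.haar_real_eq {F : Finset B} {E : Set (Odometer B)} {Q : ℤ → Prop}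
    (h : IsCylinder F E Q) [DecidablePred fun n : ℕ => Q n] :
    (haar B).real E = (Nat.count (fun n : ℕ => Q n) (∏ f ∈ F, ((f : ℕ+) : ℕ)) : ℝ) /
      (∏ f ∈ F, ((f : ℕ+) : ℕ) : ℕ) := by
  set N := ∏ f ∈ F, ((f : ℕ+) : ℕ) with hN
  have hN0 : (0 : ℝ) < N := Nat.cast_pos.2 (prod_coe_pos F)
  have hE := h.measurableSet
  have h2 : ∀ g : Odometer B, ∑ j ∈ Finset.range N,
      E.indicator (fun _ => (1 : ℝ)) ((odometerMap B ^ (j : ℤ)) g) =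
        Nat.count (fun n : ℕ => Q n) N := by
    intro g
    obtain ⟨n, hn⟩ := exists_nat_forall_eq F g
    have h3 : ∀ j : ℕ, (odometerMap B ^ (j : ℤ)) g ∈ E ↔ Q (n + j : ℕ) := fun j =>
      h _ _ fun b hb => by
        rw [odometerMap_zpow_apply_coe, hn b hb]; push_cast; rfl
    rw [← Nat.filter_Ico_card_eq_of_periodic n N _ h.periodic, Finset.card_filter,
      Finset.sum_Ico_eq_sum_range, add_tsub_cancel_left]
    push_cast
    refine Finset.sum_congr rfl fun j _ => ?_
    by_cases hq : Q (n + j : ℕ)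
    · rw [Set.indicator_of_mem ((h3 j).2 hq), if_pos (by exact_mod_cast hq)]
    · rw [Set.indicator_of_notMem (fun hm => hq ((h3 j).1 hm)), if_neg (by exact_mod_cast hq)]
  have h4 := integral_sum_odometerMap ((integrable_const (1 : ℝ)).indicator hE) N
  rw [integral_congr_ae (Eventually.of_forall h2), integral_const, probReal_univ, one_smul,
    integral_indicator_const _ hE, smul_eq_mul, mul_one] at h4
  rw [eq_div_iff hN0.ne', mul_comm, h4]

end Odometer

/-! ### Comparison of residue classes modulo `b` under Haar measure -/

section Odometer

variable {B : Set ℕ+}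

theorem measure_windowOn_inter_eq_iInf (S : Set B) {R : Set (Odometer B)} (hR : MeasurableSet R) :
    haar B (windowOn S ∩ R) = ⨅ F : Finset B, haar B (windowOn (F ∩ S) ∩ R) := by
  have h : windowOn S ∩ R = ⋂ F : Finset B, windowOn (F ∩ S) ∩ R := by
    ext g
    simp only [Set.mem_inter_iff, Set.mem_iInter, windowOn, Set.mem_ofPred_eq]
    refine ⟨fun h F => ⟨fun b hb => h.1 b hb.2, h.2⟩, fun h => ⟨fun b hb => ?_, (h ∅).2⟩⟩
    exact (h {b}).1 b ⟨by simp, hb⟩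
  rw [h, Antitone.measure_iInter]
  · intro F F' hF
    exact Set.inter_subset_inter_left _ fun g hg b hb => hg b ⟨hF hb.1, hb.2⟩
  · exact fun F => ((measurableSet_windowOn _).inter hR).nullMeasurableSet
  · exact ⟨∅, measure_ne_top _ _⟩

/-- The rotation by the integer `e` of `exists_translate` maps the left set into the right one.
Although `e` depends on `F`, the left side does not, so an infimum over `F` can be taken afterwards.
-/
theorem measure_windowOn_compl_le (b : B) {r : ZMod ((b : ℕ+) : ℕ)} (hr : r ≠ 0) (F : Finset B) :
    haar B (windowOn {b}ᶜ ∩ {g | g.1 b = 0}) ≤ haar B (windowOn F ∩ {g | g.1 b = r}) := by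
  classical
  obtain ⟨r, rfl⟩ := ZMod.intCast_surjective r
  obtain ⟨e, he⟩ := exists_translate (b : ℕ+).pos (F.image fun f : B => ((f : ℕ+) : ℕ))
    (fun f hf => by obtain ⟨c, _, rfl⟩ := Finset.mem_image.1 hf; exact (c : ℕ+).pos) r
  have hm : MeasurableSet (windowOn (F : Set B) ∩ {g : Odometer B | g.1 b = (r : ZMod _)}) :=
    (measurableSet_windowOn _).inter (measurableSet_apply_eq b _)
  rw [← (measurePreserving_odometerMap_zpow (B := B) e).measure_preimage hm.nullMeasurableSet]
  refine measure_mono ?_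
  rintro g ⟨hg, hgb⟩
  simp only [Set.mem_ofPred_eq] at hgb
  obtain ⟨n, hn⟩ := exists_int_forall_eq (insert b F) g
  have hbn : (((b : ℕ+) : ℕ) : ℤ) ∣ n := by
    rw [← ZMod.intCast_zmod_eq_zero_iff_dvd, ← hn b (Finset.mem_insert_self _ _), hgb]
  obtain ⟨h1, h2⟩ := he n hbn
  have hr' : ((odometerMap B ^ e) g).1 b = (r : ZMod ((b : ℕ+) : ℕ)) := by
    rw [odometerMap_zpow_apply_coe, hn b (Finset.mem_insert_self _ _), ← Int.cast_add,
      ← sub_eq_zero, ← Int.cast_sub, ZMod.intCast_zmod_eq_zero_iff_dvd]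
    exact h1
  refine ⟨fun f hf h0 => ?_, hr'⟩
  by_cases hfb : f = b
  · subst hfb
    exact hr (hr'.symm.trans h0)
  · refine hg f hfb ?_
    rw [odometerMap_zpow_apply_coe, hn f (Finset.mem_insert_of_mem hf), ← Int.cast_add,
      ZMod.intCast_zmod_eq_zero_iff_dvd] at h0
    rw [hn f (Finset.mem_insert_of_mem hf), ZMod.intCast_zmod_eq_zero_iff_dvd]
    exact h2 _ (Finset.mem_image_of_mem _ hf) h0

theorem measure_windowOn_compl_le_measure_window (b : B) {r : ZMod ((b : ℕ+) : ℕ)} (hr : r ≠ 0) :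
    haar B (windowOn {b}ᶜ ∩ {g | g.1 b = 0}) ≤ haar B (window B ∩ {g | g.1 b = r}) := by
  rw [← windowOn_univ, measure_windowOn_inter_eq_iInf _ (measurableSet_apply_eq b r)]
  refine le_iInf fun F => ?_
  rw [Set.inter_univ]
  exact measure_windowOn_compl_le b hr F

end Odometer

/-! ## Tautness -/

open Classical in
/-- The logarithmic averages of which `lowerLogDensity` is the lower limit. -/
def logAverage (A : Set ℤ) (N : ℕ) : ℝ :=
  (∑ a ∈ (Finset.Icc 1 N).filter (fun a : ℕ => (a : ℤ) ∈ A), (1 : ℝ) / a) / Real.log N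

theorem lowerLogDensity_eq (A : Set ℤ) : lowerLogDensity A = liminf (logAverage A) atTop := rfl

theorem logAverage_nonneg (A : Set ℤ) (N : ℕ) : 0 ≤ logAverage A N :=
  div_nonneg (Finset.sum_nonneg fun _ _ => by positivity) (Real.log_natCast_nonneg N)

theorem one_le_log {N : ℕ} (hN : 3 ≤ N) : 1 ≤ Real.log N := by
  have hx' : (3 : ℝ) ≤ N := by exact_mod_cast hN
  rw [Real.le_log_iff_exp_le (by linarith)]
  exact (Real.exp_one_lt_d9.le.trans (by norm_num)).trans hx'

theorem logAverage_le_two (A : Set ℤ) {N : ℕ} (hN : 3 ≤ N) : logAverage A N ≤ 2 := by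
  classical
  have hL := one_le_log hN
  rw [logAverage, div_le_iff₀ (by linarith)]
  calc _ ≤ ∑ a ∈ Finset.Icc 1 N, (1 : ℝ) / a :=
        Finset.sum_le_sum_of_subset_of_nonneg (Finset.filter_subset _ _)
          fun _ _ _ => by positivity
    _ = (harmonic N : ℝ) := by rw [harmonic_eq_sum_Icc]; simp
    _ ≤ 1 + Real.log N := harmonic_le_one_add_log N
    _ ≤ _ := by linarith

theorem isBoundedUnder_le_logAverage (A : Set ℤ) :
    IsBoundedUnder (· ≤ ·) atTop (logAverage A) :=
  isBoundedUnder_of_eventually_le (a := 2)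
    (eventually_atTop.2 ⟨3, fun _ hN => logAverage_le_two A hN⟩)

theorem isBoundedUnder_ge_logAverage (A : Set ℤ) :
    IsBoundedUnder (· ≥ ·) atTop (logAverage A) :=
  isBoundedUnder_of_eventually_ge (a := 0) (Eventually.of_forall (logAverage_nonneg A))

theorem lowerLogDensity_le_add {A A' : Set ℤ} {c : ℝ}
    (h : ∀ᶠ N in atTop, logAverage A N ≤ logAverage A' N + c) :
    lowerLogDensity A ≤ lowerLogDensity A' + c := by
  rw [lowerLogDensity_eq, lowerLogDensity_eq, ← sub_le_iff_le_add]
  refine le_of_forall_lt fun a ha => ?_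
  have h1 : a + c < liminf (logAverage A) atTop := by linarith
  have h2 := eventually_lt_of_lt_liminf h1 (isBoundedUnder_ge_logAverage A)
  obtain ⟨a', ha, ha'⟩ := exists_between ha
  have h3 : a' + c < liminf (logAverage A) atTop := by linarith
  have h4 := eventually_lt_of_lt_liminf h3 (isBoundedUnder_ge_logAverage A)
  refine ha.trans_le (le_liminf_of_le (isBoundedUnder_le_logAverage A').isCoboundedUnder_ge ?_)
  filter_upwards [h, h4] with N hN hN'
  linarith

theorem logAverage_le_add_of_subset {A A' D : Set ℤ} (h : A ⊆ A' ∪ D) (N : ℕ) :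
    logAverage A N ≤ logAverage A' N + logAverage D N := by
  classical
  rw [logAverage, logAverage, logAverage, ← add_div]
  refine div_le_div_of_nonneg_right ?_ (Real.log_natCast_nonneg N)
  rw [← Finset.sum_union_inter]
  refine le_add_of_le_of_nonneg ?_ (Finset.sum_nonneg fun _ _ => by positivity)
  refine Finset.sum_le_sum_of_subset_of_nonneg ?_ fun _ _ _ => by positivity
  intro a ha
  simp only [Finset.mem_union, Finset.mem_filter] at ha ⊢
  rcases h ha.2 with h' | h'
  · exact Or.inl ⟨ha.1, h'⟩
  · exact Or.inr ⟨ha.1, h'⟩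

/-- The density of a periodic set is the Haar measure of its cylinder; the bounded error `d + M`
disappears after division by `log N`. -/
theorem eventually_logAverage_le {B : Set ℕ+} {F : Finset B} {E : Set (Odometer B)} {Q : ℤ → Prop}
    (h : IsCylinder F E Q) {ε : ℝ} (hε : (haar B).real E < ε) :
    ∀ᶠ N in atTop, logAverage {n | Q n} N ≤ ε := by
  classical
  set d := (haar B).real E with hd
  set M := ∏ f ∈ F, ((f : ℕ+) : ℕ) with hM
  have ht : Tendsto (fun N : ℕ => Real.log N) atTop atTop :=
    Real.tendsto_log_atTop.comp tendsto_natCast_atTop_atTop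
  filter_upwards [ht.eventually_ge_atTop ((d + M) / (ε - d)), eventually_ge_atTop 3] with N h1 h3
  have hL := one_le_log h3
  rw [logAverage, div_le_iff₀ (by linarith)]
  have h2 := sum_inv_le_mul_log_add (prod_coe_pos F) h.periodic N
  rw [← h.haar_real_eq] at h2
  rw [div_le_iff₀ (by linarith)] at h1
  have e : ∑ a ∈ (Finset.Icc 1 N).filter (fun a : ℕ => (a : ℤ) ∈ {n | Q n}), (1 : ℝ) / a =
    ∑ a ∈ (Finset.Icc 1 N).filter (fun a : ℕ => Q a), (1 : ℝ) / a := rfl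
  rw [e]
  refine h2.trans ?_
  rw [← hd, ← hM]
  linarith

/-- Multiples lost when `b` is removed are multiples of `b` and of no other element of `B`. If the
measure were zero, finitely many coordinates would confine them to a periodic set of density below
`ε`, and the density would not drop. -/
theorem IsTaut.measure_pos {B : Set ℕ+} (hB : IsTaut B) (b : B) :
    0 < haar B (windowOn {b}ᶜ ∩ {g | g.1 b = 0}) := by
  rw [pos_iff_ne_zero]
  intro h0
  refine (hB b b.2).not_ge (le_of_forall_pos_le_add fun ε hε => ?_)
  rw [measure_windowOn_inter_eq_iInf _ (measurableSet_apply_eq b 0)] at h0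
  have h1 : (⨅ F : Finset B, haar B (windowOn (F ∩ {b}ᶜ) ∩ {g | g.1 b = 0})) < ENNReal.ofReal ε := by
    rw [h0]; exact ENNReal.ofReal_pos.2 hε
  obtain ⟨F, hF⟩ := iInf_lt_iff.1 h1
  set E : Set (Odometer B) := windowOn (F ∩ {b}ᶜ) ∩ {g | g.1 b = 0} with hE
  let Q : ℤ → Prop := fun n => (∀ f ∈ F, f ≠ b → ¬ (((f : ℕ+) : ℕ) : ℤ) ∣ n) ∧
    (((b : ℕ+) : ℕ) : ℤ) ∣ n
  classical
  have hcyl : IsCylinder (insert b F) E Q := by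
    intro g n hn
    have hb := hn b (Finset.mem_insert_self _ _)
    simp only [hE, Q, windowOn, Set.mem_inter_iff, Set.mem_ofPred_eq, Finset.mem_coe,
      Set.mem_compl_iff, Set.mem_singleton_iff, hb, ZMod.intCast_zmod_eq_zero_iff_dvd, and_imp]
    refine and_congr_left fun _ => forall₂_congr fun f hf => ?_
    rw [Ne, hn f (Finset.mem_insert_of_mem hf), ZMod.intCast_zmod_eq_zero_iff_dvd]
  have hreal : (haar B).real E < ε := by
    rw [Measure.real, ← ENNReal.lt_ofReal_iff_toReal_lt (measure_ne_top _ _)]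
    exact hF
  refine lowerLogDensity_le_add ?_
  filter_upwards [eventually_logAverage_le hcyl hreal] with N hN
  refine (logAverage_le_add_of_subset (A' := multiples (B \ {(b : ℕ+)})) (D := {n | Q n}) ?_ N).trans
    (by linarith)
  intro n hn
  by_cases h : n ∈ multiples (B \ {(b : ℕ+)})
  · exact Or.inl h
  · refine Or.inr ?_
    obtain ⟨c, hc, hcn⟩ := hn
    have hcb : c = b := by
      by_contra hne
      exact h ⟨c, ⟨hc, hne⟩, hcn⟩
    subst hcb
    exact ⟨fun f _ hfb hfn => h ⟨f, ⟨f.2, fun he => hfb (Subtype.ext he)⟩, hfn⟩, hcn⟩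

theorem IsTaut.measure_window_inter_pos {B : Set ℕ+} (hB : IsTaut B) (b : B)
    {r : ZMod ((b : ℕ+) : ℕ)} (hr : r ≠ 0) : 0 < haar B (window B ∩ {g | g.1 b = r}) :=
  (hB.measure_pos b).trans_le (measure_windowOn_compl_le_measure_window b hr)

/-! ## Generic points -/

/-- Almost every point of an ergodic system visits a given set of positive measure. -/
theorem ae_exists_zpow_mem {X : Type*} [MeasurableSpace X] {μ : Measure X} [IsFiniteMeasure μ]
    {T : Equiv.Perm X} (hT : Ergodic T μ) (hT' : Measurable T.symm) {E : Set X}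
    (hE : MeasurableSet E) (hpos : 0 < μ E) : ∀ᵐ x ∂μ, ∃ n : ℤ, (T ^ n) x ∈ E := by
  have hpow : ∀ n : ℕ, Measurable (T ^ n) ∧ Measurable (T.symm ^ n) := by
    intro n
    induction n with
    | zero => exact ⟨measurable_id, measurable_id⟩
    | succ n ih =>
      exact ⟨by rw [pow_succ]; exact ih.1.comp hT.measurable,
        by rw [pow_succ]; exact ih.2.comp hT'⟩
  have hz : ∀ n : ℤ, Measurable (T ^ n) := by
    intro n
    cases n with
    | ofNat n => exact (hpow n).1
    | negSucc n =>
      have : T ^ (Int.negSucc n) = T.symm ^ (n + 1) := by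
        rw [zpow_negSucc, ← inv_pow]; rfl
      rw [this]; exact (hpow _).2
  set U : Set X := ⋃ n : ℤ, (T ^ n) ⁻¹' E with hU
  have hUm : MeasurableSet U := MeasurableSet.iUnion fun n => hz n hE
  have hinv : T ⁻¹' U = U := by
    ext x
    simp only [hU, Set.mem_preimage, Set.mem_iUnion]
    constructor
    · rintro ⟨n, hn⟩
      exact ⟨n + 1, by rw [zpow_add, zpow_one]; exact hn⟩
    · rintro ⟨n, hn⟩
      refine ⟨n - 1, ?_⟩
      rw [← Equiv.Perm.mul_apply, ← zpow_add_one, sub_add_cancel]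
      exact hn
  rcases hT.measure_self_or_compl_eq_zero hUm hinv with h | h
  · refine absurd ?_ hpos.ne'
    exact measure_mono_null (Set.subset_iUnion_of_subset 0 (by simp)) h
  · rw [← mem_ae_iff] at h
    filter_upwards [h] with x hx
    exact Set.mem_iUnion.1 hx

/-- The points whose coding meets, modulo every `b ∈ B`, every residue class except for one. -/
def separated (B : Set ℕ+) : Set (Odometer B) :=
  {g | ∀ (b : B) (r : ZMod ((b : ℕ+) : ℕ)), r ≠ 0 →
    ∃ n : ℤ, (odometerMap B ^ n) g ∈ window B ∩ {g | g.1 b = r}}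

theorem measurable_odometerMap_zpow {B : Set ℕ+} (n : ℤ) : Measurable (odometerMap B ^ n) :=
  (measurePreserving_odometerMap_zpow n).measurable

theorem measurableSet_separated (B : Set ℕ+) : MeasurableSet (separated B) := by
  have : separated B = ⋂ (b : B) (r : ZMod ((b : ℕ+) : ℕ)) (_ : r ≠ 0), ⋃ n : ℤ,
      (odometerMap B ^ n) ⁻¹' (window B ∩ {g | g.1 b = r}) := by
    ext g; simp [separated]
  rw [this]
  refine MeasurableSet.iInter fun b => MeasurableSet.iInter fun r => MeasurableSet.iInter fun _ =>
    MeasurableSet.iUnion fun n => ?_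
  exact measurable_odometerMap_zpow n (measurableSet_window.inter (measurableSet_apply_eq b r))

theorem IsTaut.ae_mem_separated {B : Set ℕ+} (hB : IsTaut B) :
    ∀ᵐ g ∂haar B, g ∈ separated B := by
  simp only [separated, Set.mem_ofPred_eq]
  refine ae_all_iff.2 fun b => ae_all_iff.2 fun r => ?_
  by_cases hr : r = 0
  · exact Eventually.of_forall fun g h => absurd hr h
  · have hm : Measurable (odometerMap B).symm := by
      have := measurable_odometerMap_zpow (B := B) (-1)
      rwa [zpow_neg_one] at this
    filter_upwards [ae_exists_zpow_mem ergodic_odometerMap hm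
      (measurableSet_window.inter (measurableSet_apply_eq b r))
      (hB.measure_window_inter_pos b hr)] with g hg _
    exact hg

theorem fin_two_eq_of_iff {a b : Fin 2} (h : a = 1 ↔ b = 1) : a = b := by
  revert a b; decide

theorem coding_eq_one_iff {B : Set ℕ+} {g : Odometer B} {n : ℤ} :
    coding B g n = 1 ↔ (odometerMap B ^ n) g ∈ window B := by
  simp [coding]

/-- When `g` visits the window with `b`-coordinate `g_b - h_b`, the `b`-coordinate of `h` is zero,
so the two codings differ at that time. -/
theorem injOn_coding_separated (B : Set ℕ+) : Set.InjOn (coding B) (separated B) := by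
  intro g hg h hh heq
  refine Subtype.ext (funext fun b => ?_)
  by_contra hne
  obtain ⟨n, hn, hnb⟩ := hg b (g.1 b - h.1 b) (sub_ne_zero.2 hne)
  rw [Set.mem_ofPred_eq, odometerMap_zpow_apply_coe] at hnb
  rw [← coding_eq_one_iff, heq, coding_eq_one_iff] at hn
  refine hn b ?_
  rw [odometerMap_zpow_apply_coe]
  linear_combination hnb

theorem coding_odometerMap {B : Set ℕ+} (g : Odometer B) :
    coding B (odometerMap B g) = shift (coding B g) := by
  funext n
  change coding B (odometerMap B g) n = coding B g (n + 1)
  refine fin_two_eq_of_iff ?_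
  rw [coding_eq_one_iff, coding_eq_one_iff, zpow_add_one]
  rfl

theorem measurable_coding (B : Set ℕ+) : Measurable (coding B) := by
  classical
  refine measurable_pi_iff.2 fun n => ?_
  exact Measurable.ite (measurable_odometerMap_zpow n measurableSet_window)
    measurable_const measurable_const

/-! ## The Mirsky measure is concentrated on the subshift -/

theorem exists_measureReal_windowOn_sdiff_lt (B : Set ℕ+) {ε : ℝ} (hε : 0 < ε) :
    ∃ F : Finset B, (haar B).real (windowOn (F : Set B) \ window B) < ε := by
  have h := measure_windowOn_inter_eq_iInf (B := B) Set.univ MeasurableSet.univ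
  simp only [Set.inter_univ] at h
  have h1 : haar B (windowOn Set.univ) < haar B (windowOn Set.univ) + ENNReal.ofReal ε :=
    ENNReal.lt_add_right (measure_ne_top _ _) (ENNReal.ofReal_pos.2 hε).ne'
  nth_rewrite 1 [h] at h1
  obtain ⟨F, hF⟩ := iInf_lt_iff.1 h1
  refine ⟨F, ?_⟩
  rw [windowOn_univ] at hF
  have hsub : window B ⊆ windowOn (F : Set B) := fun g hg b _ => hg b
  rw [Measure.real, ← ENNReal.lt_ofReal_iff_toReal_lt (measure_ne_top _ _),
    measure_sdiff hsub measurableSet_window.nullMeasurableSet (measure_ne_top _ _)]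
  exact ENNReal.sub_lt_of_lt_add (measure_mono hsub) (by rwa [add_comm])

/-- The multiples of elements of `B` that are not multiples of elements of `F`. -/
def newMultiples (B : Set ℕ+) (F : Finset B) : Set ℤ :=
  {n | n ∈ multiples B ∧ ∀ f ∈ F, ¬ (((f : ℕ+) : ℕ) : ℤ) ∣ n}

theorem finite_setOf_coe_le (B : Set ℕ+) (x : ℕ) : {b : B | ((b : ℕ+) : ℕ) ≤ x}.Finite := by
  refine Set.Finite.of_injOn (f := fun b : B => ((b : ℕ+) : ℕ)) (t := Set.Iic x)
    (fun b hb => hb) ?_ (Set.finite_Iic x)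
  intro a _ b _ hab
  exact Subtype.ext (PNat.coe_injective hab)

open Classical in
/-- The estimate behind the theorem of Davenport and Erdős: the logarithmic size of the new
multiples is controlled by a Haar measure. -/
theorem exists_sum_inv_newMultiples_le : ∃ C : ℝ, 0 < C ∧ ∀ (B : Set ℕ+) (F : Finset B),
    ∀ᶠ x : ℕ in atTop,
      ∑ n ∈ (Finset.Icc 1 x).filter (fun n : ℕ => (n : ℤ) ∈ newMultiples B F), (1 : ℝ) / n ≤
        C * Real.log x * (haar B).real (windowOn (F : Set B) \ window B) := by
  obtain ⟨C, hC, h⟩ := exists_sum_inv_le_density_mul_log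
  refine ⟨C, hC, fun B F => ?_⟩
  -- Once `x` bounds `F`, a factor `k` free of primes up to `x` is coprime to every `f ∈ F`, so
  -- multiplication by `k` creates no multiple of `f`.
  filter_upwards [eventually_ge_atTop 3,
    eventually_ge_atTop (F.sup fun f => ((f : ℕ+) : ℕ))] with x hx hFx
  have hF : ∀ f ∈ F, ((f : ℕ+) : ℕ) ≤ x := fun f hf =>
    (Finset.le_sup (f := fun f : B => ((f : ℕ+) : ℕ)) hf).trans hFx
  -- Only elements of `B` up to `x` have positive multiples up to `x`, so below `x` the new
  -- multiples agree with a periodic set.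
  set F' : Finset B := (finite_setOf_coe_le B x).toFinset with hF'
  let Q : ℤ → Prop := fun n => (∀ f ∈ F, ¬ (((f : ℕ+) : ℕ) : ℤ) ∣ n) ∧
    ¬ ∀ f ∈ F', ¬ (((f : ℕ+) : ℕ) : ℤ) ∣ n
  have hcyl : IsCylinder (F ∪ F') (windowOn (F : Set B) \ windowOn (F' : Set B)) Q := by
    intro g n hn
    simp only [Q, windowOn, Set.mem_sdiff, Set.mem_ofPred_eq, Finset.mem_coe]
    refine and_congr (forall₂_congr fun f hf => ?_) (not_congr (forall₂_congr fun f hf => ?_))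
    · rw [hn f (Finset.mem_union_left _ hf), Ne, ZMod.intCast_zmod_eq_zero_iff_dvd]
    · rw [hn f (Finset.mem_union_right _ hf), Ne, ZMod.intCast_zmod_eq_zero_iff_dvd]
  have h1 := h (fun n : ℕ => Q n) _ x hx (prod_coe_pos (F ∪ F')) hcyl.periodic ?_
  · rw [← hcyl.haar_real_eq] at h1
    have e : (Finset.Icc 1 x).filter (fun n : ℕ => (n : ℤ) ∈ newMultiples B F) =
        (Finset.Icc 1 x).filter (fun n : ℕ => Q n) := by
      refine Finset.filter_congr fun n hn => ?_
      rw [Finset.mem_Icc] at hn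
      simp only [newMultiples, multiples, Q, Set.mem_ofPred_eq, not_forall, not_not, exists_prop]
      rw [and_comm]
      refine and_congr_right fun _ => ⟨?_, ?_⟩
      · rintro ⟨b, hb, hbn⟩
        refine ⟨⟨b, hb⟩, ?_, hbn⟩
        rw [hF', Set.Finite.mem_toFinset]
        exact (Nat.le_of_dvd hn.1 (Int.natCast_dvd_natCast.1 hbn)).trans hn.2
      · rintro ⟨b, _, hbn⟩
        exact ⟨b, b.2, hbn⟩
    rw [e]
    refine h1.trans ?_
    have hlog : 0 ≤ Real.log x := Real.log_natCast_nonneg x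
    refine mul_le_mul_of_nonneg_left (measureReal_mono ?_) (by positivity)
    exact Set.sdiff_subset_sdiff_right fun g hg b _ => hg b
  · rintro n _ _ ⟨hn1, hn2⟩ k hk
    refine ⟨fun f hf hd => hn1 f hf ?_, fun hall => hn2 fun f hf hd => hall f hf ?_⟩
    · rw [Int.natCast_dvd_natCast] at hd ⊢
      exact (coprime_of_coprime_primorial (f : ℕ+).pos (hF f hf) hk).dvd_of_dvd_mul_right hd
    · push_cast
      exact hd.mul_right _

/-! ### Blocks that do not occur in `η` are null -/

theorem eta_eq_one_iff {B : Set ℕ+} {n : ℤ} : eta B n = 1 ↔ n ∈ free B := by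
  simp [eta]

/-- Charge `n` to some `n + i ∈ D`. One factor `L` counts the shifts `i`, each injective; the other
comes from `n + i ≤ L n`, that is `1/n ≤ L/(n + i)`. -/
theorem sum_inv_le_of_exists_add_mem {Q : ℕ → Prop} [DecidablePred Q] {D : Set ℤ}
    [DecidablePred fun n : ℕ => (n : ℤ) ∈ D] {L : ℕ}
    (h : ∀ n : ℕ, Q n → ∃ i < L, ((n + i : ℕ) : ℤ) ∈ D) (x : ℕ) :
    ∑ n ∈ (Finset.Icc 1 x).filter Q, (1 : ℝ) / n ≤
      L * (L * ∑ n ∈ (Finset.Icc 1 (x + L)).filter (fun n : ℕ => (n : ℤ) ∈ D), (1 : ℝ) / n) := by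
  set S := (Finset.Icc 1 (x + L)).filter (fun n : ℕ => (n : ℤ) ∈ D) with hS
  calc ∑ n ∈ (Finset.Icc 1 x).filter Q, (1 : ℝ) / n
      ≤ ∑ n ∈ (Finset.Icc 1 x).filter Q, ∑ i ∈ Finset.range L,
          if n + i ∈ S then (1 : ℝ) / n else 0 := by
        refine Finset.sum_le_sum fun n hn => ?_
        rw [Finset.mem_filter, Finset.mem_Icc] at hn
        obtain ⟨i, hi, hD⟩ := h n hn.2
        refine le_trans (le_of_eq ?_) (Finset.single_le_sum
          (f := fun i => if n + i ∈ S then (1 : ℝ) / n else 0) (fun i _ => ?_)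
          (Finset.mem_range.2 hi))
        · rw [if_pos]
          exact Finset.mem_filter.2 ⟨Finset.mem_Icc.2 ⟨by omega, by omega⟩, hD⟩
        · split_ifs <;> positivity
    _ = ∑ i ∈ Finset.range L, ∑ n ∈ (Finset.Icc 1 x).filter Q,
          if n + i ∈ S then (1 : ℝ) / n else 0 := Finset.sum_comm
    _ ≤ ∑ i ∈ Finset.range L, (L * ∑ n ∈ S, (1 : ℝ) / n) := by
        refine Finset.sum_le_sum fun i hi => ?_
        rw [Finset.mem_range] at hi
        rw [← Finset.sum_filter, Finset.mul_sum]
        calc _ ≤ ∑ n ∈ ((Finset.Icc 1 x).filter Q).filter (fun n => n + i ∈ S),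
              L * ((1 : ℝ) / (n + i : ℕ)) := by
              refine Finset.sum_le_sum fun n hn => ?_
              simp only [Finset.mem_filter, Finset.mem_Icc] at hn
              have hn1 : 0 < n := hn.1.1.1
              rw [mul_one_div, div_le_div_iff₀ (by positivity) (by positivity)]
              have : n + i ≤ L * n := by nlinarith
              rw [one_mul]
              exact_mod_cast this
          _ = ∑ m ∈ (((Finset.Icc 1 x).filter Q).filter (fun n => n + i ∈ S)).image (· + i),
              L * ((1 : ℝ) / m) := by
              rw [Finset.sum_image (fun a _ b _ hab => Nat.add_right_cancel hab)]
          _ ≤ _ := by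
              refine Finset.sum_le_sum_of_subset_of_nonneg ?_ fun _ _ _ => by positivity
              intro m hm
              obtain ⟨n, hn, rfl⟩ := Finset.mem_image.1 hm
              exact (Finset.mem_filter.1 hn).2
    _ = _ := by rw [Finset.sum_const, Finset.card_range, nsmul_eq_mul]

/-- The points whose coding starts with a given block. -/
def codingBlock (B : Set ℕ+) {L : ℕ} (A : Fin L → Fin 2) : Set (Odometer B) :=
  {g | ∀ i : Fin L, coding B g i = A i}

theorem measureReal_codingBlock_le {B : Set ℕ+} {L : ℕ} (A : Fin L → Fin 2) (F : Finset B) :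
    (haar B).real (codingBlock B A) ≤
      (haar B).real {g | ∀ i : Fin L, (odometerMap B ^ (i : ℤ)) g ∈ windowOn (F : Set B) ↔ A i = 1} +
        L * (haar B).real (windowOn (F : Set B) \ window B) := by
  have hm : MeasurableSet (windowOn (F : Set B) \ window B) :=
    (measurableSet_windowOn _).diff measurableSet_window
  have hsub : codingBlock B A ⊆
      {g | ∀ i : Fin L, (odometerMap B ^ (i : ℤ)) g ∈ windowOn (F : Set B) ↔ A i = 1} ∪
        ⋃ i : Fin L, (odometerMap B ^ (i : ℤ)) ⁻¹' (windowOn (F : Set B) \ window B) := by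
    intro g hg
    by_cases h : g ∈ ⋃ i : Fin L,
      (odometerMap B ^ (i : ℤ)) ⁻¹' (windowOn (F : Set B) \ window B)
    · exact Or.inr h
    · refine Or.inl fun i => ?_
      simp only [Set.mem_iUnion, Set.mem_preimage, Set.mem_sdiff, not_exists, not_and, not_not] at h
      rw [← hg i, coding_eq_one_iff]
      exact ⟨h i, fun hw b _ => hw b⟩
  refine (measureReal_mono hsub).trans ((measureReal_union_le _ _).trans ?_)
  gcongr
  refine (measureReal_iUnion_fintype_le _).trans ?_
  rw [Finset.sum_congr rfl fun (i : Fin L) _ => (measurePreserving_odometerMap_zpow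
    (B := B) (i : ℤ)).measureReal_preimage hm.nullMeasurableSet]
  simp

theorem measure_codingBlock_eq_zero {B : Set ℕ+} {L : ℕ} {A : Fin L → Fin 2}
    (hA : ¬ ∃ k : ℤ, ∀ i : Fin L, eta B (k + i) = A i) : haar B (codingBlock B A) = 0 := by
  classical
  obtain ⟨C, hC, hCB⟩ := exists_sum_inv_newMultiples_le
  have hbound : ∀ F : Finset B, (haar B).real (codingBlock B A) ≤
      (4 * C * L * L + L) * (haar B).real (windowOn (F : Set B) \ window B) := by
    intro F
    set τ := (haar B).real (windowOn (F : Set B) \ window B) with hτ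
    have hτ0 : 0 ≤ τ := measureReal_nonneg
    set E : Set (Odometer B) :=
      {g | ∀ i : Fin L, (odometerMap B ^ (i : ℤ)) g ∈ windowOn (F : Set B) ↔ A i = 1} with hE
    let Q : ℤ → Prop := fun n => ∀ i : Fin L,
      (∀ f ∈ F, ¬ (((f : ℕ+) : ℕ) : ℤ) ∣ n + i) ↔ A i = 1
    have hcyl : IsCylinder F E Q := by
      intro g n hn
      simp only [hE, Q, windowOn, Set.mem_ofPred_eq, Finset.mem_coe]
      refine forall_congr' fun i => iff_congr (forall₂_congr fun f hf => ?_) Iff.rfl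
      rw [odometerMap_zpow_apply_coe, hn f hf, ← Int.cast_add, Ne,
        ZMod.intCast_zmod_eq_zero_iff_dvd]
    -- Without a new multiple among `n, …, n + L - 1` the `F`-free pattern there is that of `η`, and
    -- `A` would occur in `η`.
    have hQD : ∀ n : ℕ, Q n → ∃ i < L, ((n + i : ℕ) : ℤ) ∈ newMultiples B F := by
      intro n hn
      by_contra! hcon
      refine hA ⟨n, fun i => fin_two_eq_of_iff ?_⟩
      rw [eta_eq_one_iff, ← hn i]
      constructor
      · intro hfree f hf hd
        exact hfree ⟨f, f.2, hd⟩
      · intro hnd hmul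
        have := hcon i i.2
        refine this ⟨?_, ?_⟩
        · push_cast; exact hmul
        · push_cast; exact hnd
    set N := ∏ f ∈ F, ((f : ℕ+) : ℕ) with hN
    have ht : Tendsto (fun x : ℕ => Real.log x) atTop atTop :=
      Real.tendsto_log_atTop.comp tendsto_natCast_atTop_atTop
    have hshift : ∀ᶠ x : ℕ in atTop, ∑ n ∈ (Finset.Icc 1 (x + L)).filter
        (fun n : ℕ => (n : ℤ) ∈ newMultiples B F), (1 : ℝ) / n ≤ C * Real.log ((x + L : ℕ) : ℝ) * τ :=
      (tendsto_add_atTop_nat L).eventually (hCB B F)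
    obtain ⟨x, h1, h2, h3, h4⟩ := (hshift.and ((ht.eventually_ge_atTop (2 * Real.log N)).and
      ((eventually_ge_atTop (max L 3)).and (eventually_ge_atTop 1)))).exists
    -- For such `x` both `log x - log N ≥ (log x) / 2` and `log (x + L) ≤ 2 log x`; these two
    -- factors make the constant `4`.
    have hx3 : 3 ≤ x := (le_max_right _ _).trans h3
    have hxL : L ≤ x := (le_max_left _ _).trans h3
    have hL1 := one_le_log hx3
    have hlog : Real.log ((x + L : ℕ) : ℝ) ≤ 2 * Real.log x := by
      have : ((x + L : ℕ) : ℝ) ≤ (x : ℝ) ^ 2 := by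
        have : x + L ≤ x ^ 2 := by nlinarith
        exact_mod_cast this
      calc _ ≤ Real.log ((x : ℝ) ^ 2) := Real.log_le_log (by positivity) this
        _ = _ := by rw [Real.log_pow]; norm_num
    have h5 := mul_log_sub_le_sum_inv (prod_coe_pos F) hcyl.periodic h4
    rw [← hcyl.haar_real_eq, ← hN] at h5
    have h6 := h5.trans (sum_inv_le_of_exists_add_mem hQD x)
    have h7 : (haar B).real E * (Real.log x / 2) ≤ L * (L * (C * (2 * Real.log x) * τ)) := by
      calc (haar B).real E * (Real.log x / 2)
          ≤ (haar B).real E * (Real.log x - Real.log N) := by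
            gcongr; linarith
        _ ≤ _ := h6
        _ ≤ _ := by
            gcongr
            exact h1.trans (by gcongr)
    have h8 : (haar B).real E ≤ 4 * C * L * L * τ := by
      refine le_of_mul_le_mul_right (a := Real.log x / 2) ?_ (by linarith)
      linarith
    have := measureReal_codingBlock_le A F
    rw [← hE, ← hτ] at this
    linarith
  have hK : 0 ≤ 4 * C * L * L + L := by positivity
  have h0 : (haar B).real (codingBlock B A) ≤ 0 := by
    refine le_of_forall_pos_le_add fun ε hε => ?_
    obtain ⟨F, hF⟩ := exists_measureReal_windowOn_sdiff_lt B
      (show 0 < ε / (4 * C * L * L + L + 1) by positivity)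
    rw [zero_add]
    calc _ ≤ _ := hbound F
      _ ≤ (4 * C * L * L + L + 1) * (ε / (4 * C * L * L + L + 1)) := by
          exact mul_le_mul (by linarith) hF.le measureReal_nonneg (by positivity)
      _ = ε := by field_simp
  exact (measureReal_eq_zero_iff).1 (le_antisymm h0 measureReal_nonneg)

theorem ae_exists_coding_eq_eta (B : Set ℕ+) (L : ℕ) :
    ∀ᵐ g ∂haar B, ∃ k : ℤ, ∀ i : Fin L, coding B g i = eta B (k + i) := by
  have h : ∀ A : Fin L → Fin 2, ∀ᵐ g ∂haar B, g ∈ codingBlock B A →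
      ∃ k : ℤ, ∀ i : Fin L, eta B (k + i) = A i := by
    intro A
    by_cases hA : ∃ k : ℤ, ∀ i : Fin L, eta B (k + i) = A i
    · exact Eventually.of_forall fun _ _ => hA
    · have := measure_codingBlock_eq_zero hA
      rw [measure_eq_zero_iff_ae_notMem] at this
      filter_upwards [this] with g hg hg'
      exact absurd hg' hg
  filter_upwards [ae_all_iff.2 h] with g hg
  obtain ⟨k, hk⟩ := hg (fun i => coding B g i) fun i => rfl
  exact ⟨k, fun i => (hk i).symm⟩

theorem shift_zpow_apply (k : ℤ) (x : ℤ → Fin 2) (n : ℤ) : (shift ^ k) x n = x (n + k) := by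
  induction k generalizing n with
  | zero => simp
  | succ k ih =>
    rw [add_comm, zpow_add, zpow_one, Equiv.Perm.mul_apply]
    change (shift ^ (k : ℤ)) x (n + 1) = _
    rw [ih]; ring_nf
  | pred k ih =>
    rw [sub_eq_neg_add, zpow_add, zpow_neg_one, Equiv.Perm.mul_apply]
    change (shift ^ (-(k : ℤ))) x (n - 1) = _
    rw [ih]; ring_nf

theorem coding_odometerMap_zpow {B : Set ℕ+} (g : Odometer B) (m n : ℤ) :
    coding B ((odometerMap B ^ m) g) n = coding B g (n + m) := by
  refine fin_two_eq_of_iff ?_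
  rw [coding_eq_one_iff, coding_eq_one_iff, zpow_add]
  rfl

/-- Blocks of the coding start at `0`, so the central block on `[-m, m]` is read as the initial
block of length `2m + 1` at `T^{-m} g`. There are only countably many conditions, and rotations
preserve null sets. -/
theorem ae_coding_mem_subshift (B : Set ℕ+) : ∀ᵐ g ∂haar B, coding B g ∈ subshift B := by
  have h : ∀ m L : ℕ, ∀ᵐ g ∂haar B, ∃ k : ℤ, ∀ i : Fin L,
      coding B ((odometerMap B ^ (-m : ℤ)) g) i = eta B (k + i) := by
    intro m L
    have hq := (measurePreserving_odometerMap_zpow (B := B) (-m : ℤ)).quasiMeasurePreserving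
    exact hq.tendsto_ae.eventually
      (p := fun g => ∃ k : ℤ, ∀ i : Fin L, coding B g i = eta B (k + i))
      (ae_exists_coding_eq_eta B L)
  filter_upwards [ae_all_iff.2 fun m => ae_all_iff.2 (h m)] with g hg
  refine mem_closure_iff.2 fun U hU hgU => ?_
  obtain ⟨I, u, hu, hIU⟩ := isOpen_pi_iff.1 hU _ hgU
  set m := I.sup Int.natAbs with hm
  obtain ⟨k, hk⟩ := hg m (2 * m + 1)
  refine ⟨(shift ^ (k + m)) (eta B), hIU fun n hn => ?_, k + m, rfl⟩
  have hnm : n.natAbs ≤ m := Finset.le_sup (f := Int.natAbs) hn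
  have h1 := hk ⟨(n + m).toNat, by omega⟩
  rw [coding_odometerMap_zpow] at h1
  have h2 : (((n + m).toNat : ℕ) : ℤ) = n + m := Int.toNat_of_nonneg (by omega)
  simp only [h2, add_neg_cancel_right] at h1
  rw [shift_zpow_apply, show n + (k + m) = k + (n + m) by ring, ← h1]
  exact (hu n hn).2

/-! ## Zero entropy -/

/-- Gibbs' inequality. -/
theorem sum_negMulLog_le {ι : Type*} [Fintype ι] {p q : ι → ℝ} (hp : ∀ i, 0 ≤ p i)
    (hp1 : ∑ i, p i = 1) (hq : ∀ i, 0 < q i) (hq1 : ∑ i, q i ≤ 1) :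
    ∑ i, Real.negMulLog (p i) ≤ ∑ i, p i * -Real.log (q i) := by
  have h : ∀ i, Real.negMulLog (p i) - p i * -Real.log (q i) ≤ q i - p i := by
    intro i
    rcases (hp i).eq_or_lt with h0 | h0
    · rw [← h0]; simpa using (hq i).le
    · have h1 := Real.log_le_sub_one_of_pos (div_pos (hq i) h0)
      rw [Real.log_div (hq i).ne' h0.ne'] at h1
      have h2 := mul_le_mul_of_nonneg_left h1 h0.le
      have h3 : p i * (q i / p i - 1) = q i - p i := by field_simp
      rw [Real.negMulLog]
      linarith
  have h' := Finset.sum_le_sum fun i (_ : i ∈ Finset.univ) => h i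
  rw [Finset.sum_sub_distrib, Finset.sum_sub_distrib] at h'
  linarith

open Classical in
/-- Transition weights that put most of the mass on the diagonal. -/
def diagonalWeight (k : ℕ) (ε : ℝ) (a b : Fin k) : ℝ := if a = b then 1 - ε else ε / k

theorem diagonalWeight_pos {k : ℕ} {ε : ℝ} (h0 : 0 < ε) (h1 : ε < 1) (a b : Fin k) :
    0 < diagonalWeight k ε a b := by
  have : 0 < k := a.pos
  rw [diagonalWeight]
  split_ifs
  · linarith
  · positivity

/-- Off-diagonal weights `ε / k` leave the total slightly below one, which suffices for Gibbs'
inequality. -/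
theorem sum_diagonalWeight_le {k : ℕ} {ε : ℝ} (h0 : 0 < ε) (b : Fin k) :
    ∑ a, diagonalWeight k ε a b ≤ 1 := by
  have hk : (0 : ℝ) < k := by exact_mod_cast b.pos
  calc ∑ a, diagonalWeight k ε a b ≤ ∑ a : Fin k, ((if a = b then 1 - ε else 0) + ε / k) := by
        refine Finset.sum_le_sum fun a _ => ?_
        rw [diagonalWeight]
        split_ifs
        · have : 0 < ε / k := by positivity
          linarith
        · simp
    _ = 1 := by
        rw [Finset.sum_add_distrib, Finset.sum_ite_eq' Finset.univ b]
        simp only [Finset.mem_univ, if_true, Finset.sum_const, Finset.card_univ, Fintype.card_fin,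
          nsmul_eq_mul]
        field_simp; ring

open Classical in
theorem neg_log_diagonalWeight_le {k : ℕ} {ε : ℝ} (h0 : 0 < ε) (h1 : ε < 1) (a b : Fin k) :
    -Real.log (diagonalWeight k ε a b) ≤
      -Real.log (1 - ε) + if a = b then 0 else Real.log k - Real.log ε := by
  have hk : (0 : ℝ) < k := by exact_mod_cast b.pos
  rw [diagonalWeight]
  split_ifs
  · simp
  · rw [Real.log_div h0.ne' hk.ne']
    have := Real.log_nonpos (show 0 ≤ 1 - ε by linarith) (by linarith)
    linarith

/-- A process that is almost periodic in measure has small entropy. -/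
theorem shannonEntropy_le {X : Type*} [MeasurableSpace X] {μ : Measure X} [IsProbabilityMeasure μ]
    {N M k : ℕ} (hM : 0 < M) (hk : 0 < k) {R : X → Fin N → Fin k} (hR : Measurable R) {ε : ℝ}
    (h0 : 0 < ε) (h1 : ε < 1)
    (h : ∀ i : Fin N, μ.real {x | R x i ≠ R x ⟨i % M, (Nat.mod_le _ _).trans_lt i.2⟩} ≤ ε) :
    shannonEntropy μ R ≤
      M * Real.log k + N * (-Real.log (1 - ε) + ε * (Real.log k - Real.log ε)) := by
  classical
  have hk' : (0 : ℝ) < k := by exact_mod_cast hk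
  let c : Fin N → Fin N := fun i => ⟨i % M, (Nat.mod_le _ _).trans_lt i.2⟩
  let e : Fin N → Fin M := fun i => ⟨i % M, Nat.mod_lt _ hM⟩
  let w : (Fin M → Fin k) → (Fin N → Fin k) → ℝ := fun y x =>
    ∏ i, diagonalWeight k ε (x i) (y (e i))
  -- Trial weights for Gibbs' inequality: a uniformly random word `y` of length `M`, repeated
  -- periodically and disturbed independently in each letter.
  let q : (Fin N → Fin k) → ℝ := fun x => ((k : ℝ) ^ M)⁻¹ * ∑ y, w y x
  have hw : ∀ y x, 0 < w y x := fun y x =>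
    Finset.prod_pos fun i _ => diagonalWeight_pos h0 h1 _ _
  have hne : Nonempty (Fin M → Fin k) := ⟨fun _ => ⟨0, hk⟩⟩
  have hq : ∀ x, 0 < q x := fun x =>
    mul_pos (by positivity) (Finset.sum_pos (fun y _ => hw y x) Finset.univ_nonempty)
  have hq1 : ∑ x, q x ≤ 1 := by
    rw [← Finset.mul_sum, Finset.sum_comm]
    have h2 : ∀ y, ∑ x, w y x ≤ 1 := by
      intro y
      have : ∑ x, w y x = ∏ i : Fin N, ∑ a, diagonalWeight k ε a (y (e i)) :=
        (Finset.prod_univ_sum (fun _ : Fin N => (Finset.univ : Finset (Fin k)))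
          (fun i a => diagonalWeight k ε a (y (e i)))).symm ▸ by simp [w]
      rw [this]
      refine Finset.prod_le_one (fun i _ => ?_) fun i _ => sum_diagonalWeight_le h0 _
      exact Finset.sum_nonneg fun a _ => (diagonalWeight_pos h0 h1 _ _).le
    calc _ ≤ ((k : ℝ) ^ M)⁻¹ * ∑ _y : Fin M → Fin k, (1 : ℝ) := by
          gcongr with y; exact h2 y
      _ = 1 := by
          simp only [Finset.sum_const, Finset.card_univ, Fintype.card_fun, Fintype.card_fin,
            nsmul_eq_mul, mul_one, Nat.cast_pow]
          exact inv_mul_cancel₀ (by positivity)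
  have hlog : ∀ x, -Real.log (q x) ≤ M * Real.log k +
      ∑ i, (-Real.log (1 - ε) + if x i = x (c i) then 0 else Real.log k - Real.log ε) := by
    intro x
    -- Only the term of the word formed by the first `M` letters of `x` is kept. The filler letter,
    -- present when `N < M`, is never compared with a letter of `x`.
    let y : Fin M → Fin k := fun j => if hj : (j : ℕ) < N then x ⟨j, hj⟩ else ⟨0, hk⟩
    have hy : ∀ i, y (e i) = x (c i) := fun i =>
      dif_pos ((Nat.mod_le _ _).trans_lt i.2)
    have h3 : ((k : ℝ) ^ M)⁻¹ * w y x ≤ q x := by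
      refine mul_le_mul_of_nonneg_left ?_ (by positivity)
      exact Finset.single_le_sum (f := fun y => w y x) (fun y _ => (hw y x).le) (Finset.mem_univ y)
    have h4 := Real.log_le_log (mul_pos (by positivity) (hw y x)) h3
    rw [Real.log_mul (by positivity) (hw y x).ne', Real.log_inv, Real.log_pow,
      Real.log_prod (fun i _ => (diagonalWeight_pos h0 h1 _ _).ne')] at h4
    have h5 := Finset.sum_le_sum fun i (_ : i ∈ Finset.univ) =>
      neg_log_diagonalWeight_le h0 h1 (x i) (y (e i))
    rw [Finset.sum_neg_distrib] at h5
    simp only [hy] at h4 h5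
    linarith
  have hp1 : ∑ x, μ.real (R ⁻¹' {x}) = 1 := by
    rw [sum_measureReal_preimage_singleton _ fun x _ => hR (measurableSet_singleton x)]
    simp
  refine (sum_negMulLog_le (fun _ => measureReal_nonneg) hp1 hq hq1).trans ?_
  calc ∑ x, μ.real (R ⁻¹' {x}) * -Real.log (q x)
      ≤ ∑ x, μ.real (R ⁻¹' {x}) * (M * Real.log k +
          ∑ i, (-Real.log (1 - ε) + if x i = x (c i) then 0 else Real.log k - Real.log ε)) :=
        Finset.sum_le_sum fun x _ => mul_le_mul_of_nonneg_left (hlog x) measureReal_nonneg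
    _ = M * Real.log k + ∑ i, (-Real.log (1 - ε) +
          (∑ x, if x i = x (c i) then 0 else μ.real (R ⁻¹' {x})) * (Real.log k - Real.log ε)) := by
        simp only [mul_add, Finset.sum_add_distrib, Finset.mul_sum, Finset.sum_mul]
        rw [← Finset.sum_mul, hp1, one_mul, Finset.sum_comm (f := fun x _ =>
          μ.real (R ⁻¹' {x}) * -Real.log (1 - ε)), Finset.sum_comm (f := fun x i =>
          μ.real (R ⁻¹' {x}) * if x i = x (c i) then 0 else Real.log k - Real.log ε)]
        congr 2
        · refine Finset.sum_congr rfl fun i _ => ?_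
          rw [← Finset.sum_mul, hp1, one_mul]
        · refine Finset.sum_congr rfl fun i _ => Finset.sum_congr rfl fun x _ => ?_
          split_ifs <;> simp
    _ ≤ M * Real.log k + ∑ _i : Fin N, (-Real.log (1 - ε) + ε * (Real.log k - Real.log ε)) := by
        have hl : 0 ≤ Real.log k - Real.log ε := by
          have := Real.log_natCast_nonneg k
          have := Real.log_nonpos h0.le h1.le
          linarith
        gcongr with i
        refine le_trans (le_of_eq ?_) (h i)
        have e1 : (∑ x, if x i = x (c i) then 0 else μ.real (R ⁻¹' {x})) =
            ∑ x with ¬ x i = x (c i), μ.real (R ⁻¹' {x}) := by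
          simp only [Finset.sum_filter, ite_not]
        rw [e1, sum_measureReal_preimage_singleton _ fun x _ => hR (measurableSet_singleton x)]
        congr 1
        ext x
        simp [c]
    _ = _ := by simp only [Finset.sum_const, Finset.card_univ, Fintype.card_fin, nsmul_eq_mul]

/-! ### Continuity of translations in measure and the entropy of the odometer -/

theorem tendsto_measure_translate_symmDiff {B : Set ℕ+} {s : Set (Odometer B)}
    (hs : MeasurableSet s) :
    Tendsto (fun h : Odometer B => haar B (symmDiff ((· + h) ⁻¹' s) s)) (𝓝 0) (𝓝 0) := by
  let f : C(Odometer B, C(Odometer B, Odometer B)) :=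
    ContinuousMap.curry ⟨fun p : Odometer B × Odometer B => p.2 + p.1, by fun_prop⟩
  have h0 : ∀ h, MeasurePreserving (f h) (haar B) (haar B) := fun h =>
    measurePreserving_add_right (haar B) h
  have h1 := tendsto_measure_symmDiff_preimage_nhds_zero (f.continuous.tendsto 0)
    (Eventually.of_forall h0) (h0 0) hs.nullMeasurableSet (measure_ne_top _ _)
  have h2 : (f 0) ⁻¹' s = s := by
    ext g
    change g + 0 ∈ s ↔ g ∈ s
    rw [add_zero]
  rw [h2] at h1
  exact h1

theorem eventually_measureReal_ne_translate_lt {B : Set ℕ+} {k : ℕ} {Q : Odometer B → Fin k}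
    (hQ : Measurable Q) {ε : ℝ} (hε : 0 < ε) :
    ∀ᶠ h : Odometer B in 𝓝 0, (haar B).real {g | Q (g + h) ≠ Q g} < ε := by
  have h1 : Tendsto (fun h : Odometer B =>
      ∑ a, haar B (symmDiff ((· + h) ⁻¹' (Q ⁻¹' {a})) (Q ⁻¹' {a}))) (𝓝 0) (𝓝 0) := by
    have := tendsto_finsetSum (Finset.univ : Finset (Fin k)) fun a _ =>
      tendsto_measure_translate_symmDiff (hQ (measurableSet_singleton a))
    simpa using this
  filter_upwards [h1.eventually_lt_const (ENNReal.ofReal_pos.2 hε)] with h hh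
  rw [Measure.real, ← ENNReal.lt_ofReal_iff_toReal_lt (measure_ne_top _ _)]
  refine lt_of_le_of_lt ?_ hh
  refine (measure_mono ?_).trans (measure_iUnion_fintype_le _ _)
  intro g hg
  exact Set.mem_iUnion.2 ⟨Q g, Or.inr ⟨rfl, hg⟩⟩

theorem exists_finset_forall_mem {B : Set ℕ+} {U : Set (Odometer B)} (hU : U ∈ 𝓝 0) :
    ∃ F : Finset B, ∀ g : Odometer B, (∀ b ∈ F, g.1 b = 0) → g ∈ U := by
  obtain ⟨V, hV, hVU⟩ := mem_nhds_subtype _ _ _ |>.1 hU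
  obtain ⟨W, hWV, hW, h0⟩ := mem_nhds_iff.1 hV
  obtain ⟨F, u, hu, hF⟩ := isOpen_pi_iff.1 hW _ h0
  refine ⟨F, fun g hg => hVU (hWV (hF fun b hb => ?_))⟩
  rw [hg b hb]
  exact (hu b hb).2

theorem tendsto_entropyBound (k : ℕ) :
    Tendsto (fun ε : ℝ => -Real.log (1 - ε) + ε * (Real.log k - Real.log ε)) (𝓝[>] 0) (𝓝 0) := by
  have h : ContinuousAt (fun ε : ℝ => -Real.log (1 - ε) + (ε * Real.log k + Real.negMulLog ε)) 0 := by
    refine ContinuousAt.add ?_ ?_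
    · exact ((continuousAt_const.sub continuousAt_id).log (by simp)).neg
    · exact (continuousAt_id.mul continuousAt_const).add Real.continuous_negMulLog.continuousAt
  have h' := h.tendsto
  simp only [sub_zero, Real.log_one, neg_zero, zero_mul, Real.negMulLog_zero, add_zero] at h'
  refine (h'.mono_left nhdsWithin_le_nhds).congr fun ε => ?_
  rw [Real.negMulLog]; ring

/-- All multiples of `M` vanish in the coordinates `F`, so they are uniformly close to zero in `G`.
Thus `Q ∘ T^i` and `Q ∘ T^(i % M)` differ on a set of measure at most `ε` for every `i`, without
accumulation of errors. -/
theorem partitionEntropy_odometerMap {B : Set ℕ+} {k : ℕ} {Q : Odometer B → Fin k}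
    (hQ : Measurable Q) : partitionEntropy (odometerMap B) (haar B) Q = 0 := by
  rw [← nonpos_iff_eq_zero]
  refine ENNReal.le_of_forall_pos_le_add fun δ hδ _ => ?_
  rw [zero_add]
  have hk : 0 < k := (Q 0).pos
  have hδ' : (0 : ℝ) < δ / 2 := by positivity
  obtain ⟨ε, hε, hε0, hε1⟩ := ((tendsto_entropyBound k).eventually_lt_const hδ' |>.and
    (Ioo_mem_nhdsGT one_pos)).exists
  obtain ⟨F, hF⟩ := exists_finset_forall_mem (eventually_measureReal_ne_translate_lt hQ hε0)
  set M := ∏ f ∈ F, ((f : ℕ+) : ℕ) with hM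
  have hM0 : 0 < M := prod_coe_pos F
  have hiter : ∀ (i : ℕ) (g : Odometer B), (odometerMap B)^[i] g = g + (i : ℤ) • odometerOne B := by
    intro i g
    rw [← odometerMap_zpow_apply, zpow_natCast, ← Equiv.Perm.iterate_eq_pow]
  have hmeas : ∀ i : ℕ, Measurable ((odometerMap B)^[i]) := fun i =>
    ergodic_odometerMap.measurable.iterate i
  have hnear : ∀ i : ℕ, (haar B).real
      {g | Q ((odometerMap B)^[i] g) ≠ Q ((odometerMap B)^[i % M] g)} ≤ ε := by
    intro i
    set h : Odometer B := ((M * (i / M) : ℕ) : ℤ) • odometerOne B with hh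
    have h1 : (haar B).real {g | Q (g + h) ≠ Q g} < ε := by
      refine hF h fun b hb => ?_
      rw [hh, zsmul_odometerOne_apply, ZMod.intCast_zmod_eq_zero_iff_dvd, Int.natCast_dvd_natCast]
      exact (Finset.dvd_prod_of_mem (fun f : B => ((f : ℕ+) : ℕ)) hb).mul_right _
    have hmp := measurePreserving_odometerMap_zpow (B := B) ((i % M : ℕ) : ℤ)
    have hms : MeasurableSet {g | Q (g + h) ≠ Q g} :=
      (measurableSet_eq_fun (hQ.comp (measurable_add_const h)) hQ).compl
    rw [← hmp.measureReal_preimage hms.nullMeasurableSet] at h1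
    refine le_trans (le_of_eq ?_) h1.le
    congr 1
    ext g
    simp only [Set.mem_ofPred_eq, Set.mem_preimage, hiter, odometerMap_zpow_apply]
    rw [add_assoc, hh, ← add_zsmul, ← Nat.cast_add, Nat.mod_add_div]
  refine limsup_le_of_le (by isBoundedDefault) ?_
  have hlarge : Tendsto (fun N : ℕ => M * Real.log k / N) atTop (𝓝 0) :=
    tendsto_const_nhds.div_atTop tendsto_natCast_atTop_atTop
  filter_upwards [hlarge.eventually_lt_const hδ', eventually_gt_atTop 0] with N hN hN0
  have hN' : (0 : ℝ) < N := by exact_mod_cast hN0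
  have hbound := shannonEntropy_le (μ := haar B) hM0 hk
    (R := fun x => fun i : Fin N => Q ((odometerMap B)^[i] x))
    (measurable_pi_iff.2 fun i => hQ.comp (hmeas i)) hε0 hε1 fun i => hnear i
  rw [← ENNReal.ofReal_coe_nnreal]
  refine ENNReal.ofReal_le_ofReal ?_
  rw [div_lt_iff₀ hN'] at hN
  rw [div_le_iff₀ hN']
  have := mul_lt_mul_of_pos_left hε hN'
  linarith

/-! ## The isomorphism -/

section Iso

variable {B : Set ℕ+}

theorem isClosed_subshift : IsClosed (subshift B) := isClosed_closure

theorem eta_mem_subshift : eta B ∈ subshift B := subset_closure ⟨0, rfl⟩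

theorem mirskyOnSubshift_apply {s : Set (subshift B)} (hs : MeasurableSet s) :
    mirskyOnSubshift B s = haar B (coding B ⁻¹' (Subtype.val '' s)) := by
  have he := MeasurableEmbedding.subtype_coe (isClosed_subshift (B := B)).measurableSet
  rw [mirskyOnSubshift, he.comap_apply, mirskyMeasure, Measure.map_apply (measurable_coding B)
    (he.measurableSet_image.2 hs)]

open Classical in
/-- The coding map with values in the subshift, changed on a null set. -/
def codingSubshift (B : Set ℕ+) (g : Odometer B) : subshift B :=
  if h : coding B g ∈ subshift B then ⟨coding B g, h⟩ else ⟨eta B, eta_mem_subshift⟩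

theorem codingSubshift_of_mem {g : Odometer B} (h : coding B g ∈ subshift B) :
    codingSubshift B g = ⟨coding B g, h⟩ := dif_pos h

theorem measurable_codingSubshift : Measurable (codingSubshift B) := by
  classical
  have hm : MeasurableSet {g | coding B g ∈ subshift B} :=
    measurable_coding B isClosed_subshift.measurableSet
  refine Measurable.subtype_mk (p := fun x => x ∈ subshift B)
    (f := fun g => (codingSubshift B g : ℤ → Fin 2)) ?_ (h := fun g => (codingSubshift B g).2)
  have e : (fun g => (codingSubshift B g : ℤ → Fin 2)) =
      fun g => if coding B g ∈ subshift B then coding B g else eta B := by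
    funext g
    rw [codingSubshift]
    split_ifs <;> rfl
  rw [e]
  exact Measurable.ite hm (measurable_coding B) measurable_const

theorem measurePreserving_codingSubshift :
    MeasurePreserving (codingSubshift B) (haar B) (mirskyOnSubshift B) := by
  refine ⟨measurable_codingSubshift, Measure.ext fun s hs => ?_⟩
  rw [Measure.map_apply measurable_codingSubshift hs, mirskyOnSubshift_apply hs]
  refine measure_congr ?_
  filter_upwards [ae_coding_mem_subshift B] with g hg
  refine propext ?_
  change codingSubshift B g ∈ s ↔ coding B g ∈ Subtype.val '' s
  rw [codingSubshift_of_mem hg]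
  exact ⟨fun h => ⟨_, h, rfl⟩, fun ⟨x, hx, hxg⟩ => by
    have : x = ⟨coding B g, hg⟩ := Subtype.ext hxg
    rwa [← this]⟩

theorem isProbabilityMeasure_mirskyOnSubshift : IsProbabilityMeasure (mirskyOnSubshift B) :=
  ⟨by rw [← measurePreserving_codingSubshift.measure_preimage MeasurableSet.univ.nullMeasurableSet,
    Set.preimage_univ, measure_univ]⟩

theorem coding_odometerMap_mem_iff {g : Odometer B} :
    coding B (odometerMap B g) ∈ subshift B ↔ coding B g ∈ subshift B := by
  rw [coding_odometerMap, shift_mem_subshift_iff]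

theorem codingSubshift_odometerMap {g : Odometer B} (h : coding B g ∈ subshift B) :
    codingSubshift B (odometerMap B g) = subshiftMap B (codingSubshift B g) := by
  rw [codingSubshift_of_mem h, codingSubshift_of_mem (coding_odometerMap_mem_iff.2 h)]
  exact Subtype.ext (coding_odometerMap g)

theorem measurable_subshiftMap : Measurable (subshiftMap B) :=
  (continuous_shift.measurable.comp measurable_subtype_coe).subtype_mk

theorem measurePreserving_odometerMap : MeasurePreserving (odometerMap B) (haar B) (haar B) :=
  ergodic_odometerMap.toMeasurePreserving

/-- Invariance is transported from Haar measure along the factor map `codingSubshift`, which is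
equivariant almost everywhere. -/
theorem measurePreserving_subshiftMap :
    MeasurePreserving (subshiftMap B) (mirskyOnSubshift B) (mirskyOnSubshift B) := by
  refine ⟨measurable_subshiftMap, ?_⟩
  have h1 := measurePreserving_codingSubshift.comp (measurePreserving_odometerMap (B := B))
  have h2 : subshiftMap B ∘ codingSubshift B =ᵐ[haar B] codingSubshift B ∘ odometerMap B := by
    filter_upwards [ae_coding_mem_subshift B] with g hg
    exact (codingSubshift_odometerMap hg).symm
  have h3 := measurePreserving_codingSubshift (B := B)
  calc (mirskyOnSubshift B).map (subshiftMap B)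
      = ((haar B).map (codingSubshift B)).map (subshiftMap B) := by rw [h3.map_eq]
    _ = (haar B).map (subshiftMap B ∘ codingSubshift B) :=
        Measure.map_map measurable_subshiftMap h3.measurable
    _ = (haar B).map (codingSubshift B ∘ odometerMap B) := Measure.map_congr h2
    _ = mirskyOnSubshift B := h1.map_eq

/-- The set on which the coding map is an isomorphism. -/
def isoSource (B : Set ℕ+) : Set (Odometer B) := separated B ∩ {g | coding B g ∈ subshift B}

theorem measurableSet_isoSource : MeasurableSet (isoSource B) :=
  (measurableSet_separated B).inter (measurable_coding B isClosed_subshift.measurableSet)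

theorem odometerMap_mem_separated_iff {g : Odometer B} :
    odometerMap B g ∈ separated B ↔ g ∈ separated B := by
  simp only [separated, Set.mem_ofPred_eq]
  refine forall₃_congr fun b r _ => ⟨fun ⟨n, hn⟩ => ⟨n + 1, ?_⟩, fun ⟨n, hn⟩ => ⟨n - 1, ?_⟩⟩
  · rw [zpow_add_one]; exact hn
  · rw [← Equiv.Perm.mul_apply, ← zpow_add_one, sub_add_cancel]; exact hn

theorem odometerMap_mem_isoSource_iff {g : Odometer B} :
    odometerMap B g ∈ isoSource B ↔ g ∈ isoSource B :=
  and_congr odometerMap_mem_separated_iff coding_odometerMap_mem_iff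

/-- The image of `isoSource` in the subshift. -/
def isoTarget (B : Set ℕ+) : Set (subshift B) := codingSubshift B '' isoSource B

theorem injOn_codingSubshift : Set.InjOn (codingSubshift B) (isoSource B) := by
  intro g hg h hh heq
  rw [codingSubshift_of_mem hg.2, codingSubshift_of_mem hh.2, Subtype.mk.injEq] at heq
  exact injOn_coding_separated B hg.1 hh.1 heq

/-- Lusin–Souslin theorem: `G` is Polish, and an injective Borel map sends Borel sets to Borel sets.
This makes the inverse of the coding measurable. -/
theorem measurableSet_image_codingSubshift {s : Set (Odometer B)} (hs : MeasurableSet s)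
    (hs' : s ⊆ isoSource B) : MeasurableSet (codingSubshift B '' s) :=
  hs.image_of_measurable_injOn measurable_codingSubshift (injOn_codingSubshift.mono hs')

theorem subshiftMap_preimage_isoTarget : subshiftMap B ⁻¹' isoTarget B = isoTarget B := by
  ext x
  constructor
  · rintro ⟨g, hg, hgx⟩
    obtain ⟨g, rfl⟩ := (odometerMap B).surjective g
    have hg' := odometerMap_mem_isoSource_iff.1 hg
    rw [codingSubshift_odometerMap hg'.2] at hgx
    exact ⟨g, hg', (subshiftMap B).injective hgx⟩
  · rintro ⟨g, hg, rfl⟩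
    exact ⟨odometerMap B g, odometerMap_mem_isoSource_iff.2 hg, codingSubshift_odometerMap hg.2⟩

theorem IsTaut.measure_isoSource_compl (hB : IsTaut B) : haar B (isoSource B)ᶜ = 0 := by
  rw [← mem_ae_iff]
  filter_upwards [hB.ae_mem_separated, ae_coding_mem_subshift B] with g h1 h2 using ⟨h1, h2⟩

theorem IsTaut.measure_isoTarget_compl (hB : IsTaut B) :
    mirskyOnSubshift B (isoTarget B)ᶜ = 0 := by
  have hm : MeasurableSet (isoTarget B) :=
    measurableSet_image_codingSubshift measurableSet_isoSource subset_rfl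
  rw [← measurePreserving_codingSubshift.measure_preimage hm.compl.nullMeasurableSet]
  refine measure_mono_null ?_ hB.measure_isoSource_compl
  exact fun g hg hg' => hg ⟨g, hg', rfl⟩

/-- The coding map as a Borel isomorphism. -/
def codingEquiv (B : Set ℕ+) : isoSource B ≃ᵐ isoTarget B where
  toEquiv := Equiv.Set.imageOfInjOn (codingSubshift B) (isoSource B) injOn_codingSubshift
  measurable_toFun := (measurable_codingSubshift.comp measurable_subtype_coe).subtype_mk
  measurable_invFun := by
    intro s hs
    have hs' : MeasurableSet (Subtype.val '' s : Set (Odometer B)) :=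
      measurableSet_isoSource.subtype_image hs
    refine ⟨codingSubshift B '' (Subtype.val '' s),
      measurableSet_image_codingSubshift hs' (by simp), ?_⟩
    ext x
    obtain ⟨g, rfl⟩ := (Equiv.Set.imageOfInjOn (codingSubshift B) (isoSource B)
      injOn_codingSubshift).surjective x
    change codingSubshift B g ∈ codingSubshift B '' (Subtype.val '' s) ↔ (Equiv.Set.imageOfInjOn (codingSubshift B) (isoSource B)
      injOn_codingSubshift).symm (Equiv.Set.imageOfInjOn (codingSubshift B) (isoSource B)
      injOn_codingSubshift g) ∈ s
    rw [Equiv.symm_apply_apply]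
    constructor
    · rintro ⟨_, ⟨h, hh, rfl⟩, heq⟩
      rwa [← Subtype.ext (injOn_codingSubshift h.2 g.2 heq)]
    · intro hg
      exact ⟨g, ⟨g, hg, rfl⟩, rfl⟩

theorem codingEquiv_apply_coe (g : isoSource B) :
    ((codingEquiv B g : isoTarget B) : subshift B) = codingSubshift B g := rfl

theorem IsTaut.measurePreserving_codingEquiv (hB : IsTaut B) :
    MeasurePreserving (codingEquiv B) ((haar B).comap Subtype.val)
      ((mirskyOnSubshift B).comap Subtype.val) := by
  refine ⟨(codingEquiv B).measurable, Measure.ext fun s hs => ?_⟩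
  have hmt : MeasurableSet (isoTarget B) :=
    measurableSet_image_codingSubshift measurableSet_isoSource subset_rfl
  rw [Measure.map_apply (codingEquiv B).measurable hs,
    (MeasurableEmbedding.subtype_coe measurableSet_isoSource).comap_apply,
    (MeasurableEmbedding.subtype_coe hmt).comap_apply,
    ← measurePreserving_codingSubshift.measure_preimage
      (hmt.subtype_image hs).nullMeasurableSet]
  refine measure_congr ?_
  filter_upwards [mem_ae_iff.2 hB.measure_isoSource_compl] with g hg
  refine propext ⟨?_, ?_⟩
  · rintro ⟨h, hh, rfl⟩
    exact ⟨codingEquiv B h, hh, rfl⟩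
  · rintro ⟨x, hx, hxg⟩
    refine ⟨⟨g, hg⟩, ?_, rfl⟩
    have : x = codingEquiv B ⟨g, hg⟩ := Subtype.ext hxg
    rw [Set.mem_preimage, ← this]
    exact hx

/-- The isomorphism of the odometer and the subshift with the Mirsky measure. -/
def IsTaut.systemIso (hB : IsTaut B) :
    SystemIso (odometerMap B) (haar B) (subshiftMap B) (mirskyOnSubshift B) where
  source := isoSource B
  target := isoTarget B
  measurableSet_source := measurableSet_isoSource
  measurableSet_target := measurableSet_image_codingSubshift measurableSet_isoSource subset_rfl
  source_full := hB.measure_isoSource_compl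
  target_full := hB.measure_isoTarget_compl
  source_invariant := Set.ext fun _ => odometerMap_mem_isoSource_iff
  target_invariant := subshiftMap_preimage_isoTarget
  toEquiv := codingEquiv B
  measurePreserving := hB.measurePreserving_codingEquiv
  equivariant := fun x y hxy => by
    rw [codingEquiv_apply_coe, codingEquiv_apply_coe, hxy, codingSubshift_odometerMap x.2.2]

theorem codingSubshift_iterate (i : ℕ) {g : Odometer B} (h : coding B g ∈ subshift B) :
    codingSubshift B ((odometerMap B)^[i] g) = (subshiftMap B)^[i] (codingSubshift B g) := by
  induction i generalizing g with
  | zero => rfl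
  | succ i ih =>
    rw [Function.iterate_succ_apply, Function.iterate_succ_apply,
      ih (coding_odometerMap_mem_iff.2 h), codingSubshift_odometerMap h]

/-- A partition of the subshift pulls back along `codingSubshift` to one of the odometer with the
same joint distributions, hence the same entropy. A factor map is enough here. -/
theorem measureEntropy_subshiftMap : measureEntropy (subshiftMap B) (mirskyOnSubshift B) = 0 := by
  simp only [measureEntropy, ENNReal.iSup_eq_zero]
  intro k P hP
  rw [← partitionEntropy_odometerMap (B := B) (hP.comp measurable_codingSubshift)]
  have h : ∀ N : ℕ, shannonEntropy (mirskyOnSubshift B)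
      (fun x => fun i : Fin N => P ((subshiftMap B)^[i] x)) =
      shannonEntropy (haar B)
        (fun g => fun i : Fin N => (P ∘ codingSubshift B) ((odometerMap B)^[i] g)) := by
    intro N
    refine Finset.sum_congr rfl fun a _ => congrArg _ ?_
    have hm : Measurable fun x => fun i : Fin N => P ((subshiftMap B)^[i] x) :=
      measurable_pi_iff.2 fun i => hP.comp (measurable_subshiftMap.iterate i)
    rw [← measurePreserving_codingSubshift.measureReal_preimage
      (hm (measurableSet_singleton a)).nullMeasurableSet]
    refine measureReal_congr ?_
    filter_upwards [ae_coding_mem_subshift B] with g hg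
    refine propext ?_
    change (fun i : Fin N => P ((subshiftMap B)^[i] (codingSubshift B g))) = a ↔
      (fun i : Fin N => P (codingSubshift B ((odometerMap B)^[i] g))) = a
    simp only [codingSubshift_iterate _ hg]
  simp only [partitionEntropy, h]

end Iso

end BFree

end

theorem mainTheorem9 (B : Set ℕ+) (hB : BFree.IsTaut B) :
    -- the odometer and the subshift with the Mirsky measure are measure-preserving systems
    IsProbabilityMeasure (BFree.haar B) ∧
    MeasurePreserving (BFree.odometerMap B) (BFree.haar B) (BFree.haar B) ∧
    IsProbabilityMeasure (BFree.mirskyOnSubshift B) ∧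
    MeasurePreserving (BFree.subshiftMap B)
      (BFree.mirskyOnSubshift B) (BFree.mirskyOnSubshift B) ∧
    -- the coding map is an isomorphism between them
    (∃ Φ : BFree.SystemIso (BFree.odometerMap B) (BFree.haar B)
        (BFree.subshiftMap B) (BFree.mirskyOnSubshift B),
      ∀ g : Φ.source,
        (((Φ.toEquiv g : Φ.target) : BFree.subshift B) : ℤ → Fin 2) = BFree.coding B g) ∧
    -- zero entropy
    BFree.measureEntropy (BFree.subshiftMap B) (BFree.mirskyOnSubshift B) = 0 :=
  ⟨inferInstance, BFree.measurePreserving_odometerMap, BFree.isProbabilityMeasure_mirskyOnSubshift,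
    BFree.measurePreserving_subshiftMap,
    ⟨hB.systemIso, fun g => congrArg Subtype.val (BFree.codingSubshift_of_mem g.2.2)⟩,
    BFree.measureEntropy_subshiftMap⟩
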